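/- **Theorem (MetaGrad Full regret bound).** *Setting.* In rounds $t=1,2,\dots$ a convex domain $\mathcal U_t\subseteq\mathbb R^d$ with $0\in\mathcal U_t$ is revealed, the learner plays $w_t\in\mathcal U_t$, and then receives a vector $g_t\in\mathbb R^d$ (a subgradient at $w_t$ of the round's convex loss) and a number $b_t$ with $b_t\ge|(w-w_t)^\top g_t|$ for all $w\in\mathcal U_t$. Domains, gradients and range bounds are otherwise arbitrary. Put $B_0=0$, $B_t=\max_{s\le t}b_s$, and read quotients $0/0$ as $0$. *Algorithm.* MetaGrad Full with parameter $\sigma>0$ uses the grid $\mathcal G=\{2^i:i\in\mathbb Z\}$ and in round $t$ the active set $\mathcal A_t=\emptyset$ if $B_{t-1}=0$, and otherwise $$\mathcal A_t=\mathcal G\cap\Big(\tfrac{1}{2(\sum_{s=1}^{t-1}b_sB_{s-1}/B_s+B_{t-1})},\ \tfrac1{2B_{t-1}}\Big].$$ Each $\eta\in\mathcal G$ has an expert that, when $\eta$ first becomes active, is started with weight $p(\eta)=1$ and $\check w^\eta=0$, $\Lambda^\eta=\sigma^{-2}I$, $\Sigma^\eta=\sigma^2I$. In every round $t$ with $\eta\in\mathcal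 A_t$ the expert predicts $w_t^\eta\in\arg\min_{u\in\mathcal U_t}(u-\check w_t^\eta)^\top\Lambda_t^\eta(u-\check w_t^\eta)$ (these minima are assumed to be attained, which is automatic for closed $\mathcal U_t$) and, after $g_t$ is observed, updates $$\Sigma^\eta_{t+1}=\Sigma^\eta_t-\frac{2\eta^2(\Sigma^\eta_tg_t)(g_t^\top\Sigma^\eta_t)}{1+2\eta^2g_t^\top\Sigma^\eta_tg_t},\qquad \Lambda^\eta_{t+1}=\Lambda^\eta_t+2\eta^2g_tg_t^\top,$$ $$\check w^\eta_{t+1}=w^\eta_t-\big(1+2\eta(w^\eta_t-w_t)^\top g_t\big)\,\eta\,\Sigma^\eta_{t+1}g_t .$$ The controller plays $w_t=0$ if $\mathcal A_t=\emptyset$, and otherwise $w_t=\sum_{\eta\in\mathcal A_t}p_t(\eta)\,\eta\,w_t^\eta\big/\sum_{\eta\in\mathcal A_t}p_t(\eta)\,\eta$. Let $\tau$ be the last round before $t$ after which a reset took place ($\tau=0$ if there was none). If $B_t>B_\tau\sum_{s=1}^tb_s/B_s$, there is a reset after round $t$: $p_{t+1}(\eta)=1$ for all $\eta\in\mathcal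 A_t$. Otherwise, for all $\eta\in\mathcal A_t$, $$p_{t+1}(\eta)=\frac{p_t(\eta)\,e^{-\bar\ell_t^\eta(w_t^\eta)}}{\sum_{\zeta\in\mathcal A_t}p_t(\zeta)\,e^{-\bar\ell_t^\zeta(w_t^\zeta)}}\sum_{\zeta\in\mathcal A_t}p_t(\zeta),\qquad \bar\ell_t^\eta(u)=\eta(u-w_t)^\top\bar g_t+\big(\eta(u-w_t)^\top\bar g_t\big)^2,\quad \bar g_t=\frac{B_{t-1}}{B_t}g_t .$$ *Claim.* Let $T$ be such that $B_T>0$. For every $u\in\bigcap_{t=1}^T\mathcal U_t$ let $\tilde R_T^u=\sum_{t=1}^T(w_t-u)^\top g_t$ and $V_T^u=\sum_{t=1}^T((u-w_t)^\top g_t)^2$; let $F_T=\sum_{t=1}^Tg_tg_t^\top$ and $\lceil z\rceil_+=\max\{\lceil z\rceil,1\}$. Then $$\tilde R_T^u\le\tfrac52\sqrt{V_T^u\Big(\tfrac{\|u\|_2^2}{2\sigma^2}+Z_T\Big)}+5B_T\Big(\tfrac{\|u\|_2^2}{2\sigma^2}+Z_T\Big)+2B_T,$$ where $$Z_T=\operatorname{rk}(F_T)\ln\Big(1+\frac{\sigma^2\sum_{t=1}^T\|g_t\|_2^2}{2B_T^2\operatorname{rk}(F_T)}\Big)+2\ln\lceil2\log_2T\rceil_++\tfrac12$$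 (the first term being $0$ if $\operatorname{rk}(F_T)=0$), and simultaneously $$\tilde R_T^u\le\tfrac52\sqrt{\Big(V_T^u+2\sigma^2\sum_{t=1}^T\|g_t\|_2^2\Big)\Big(\tfrac{\|u\|_2^2}{2\sigma^2}+Z_T'\Big)}+5B_T\Big(\tfrac{\|u\|_2^2}{2\sigma^2}+Z'_T\Big)+2B_T,\qquad Z_T'=2\ln\lceil2\log_2T\rceil_++\tfrac12 .$$ -/

import Mathlib

namespace MetaGrad

noncomputable section

open Matrix

/-- The Euclidean square norm of a vector of `ℝ^d`. -/
def sqNorm {d : ℕ} (u : Fin d → ℝ) : ℝ := u ⬝ᵥ u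

/-- The running maximum `B_t = max_{s ≤ t} b_s` of the range bounds `b_1, b_2, …`, with `B_0 = 0`.
(Range bounds are nonnegative.) -/
def runMax (b : ℕ → ℝ) : ℕ → ℝ
  | 0 => 0
  | t + 1 => max (runMax b t) (b (t + 1))

/-- The infinite grid of learning rates `{2^i : i ∈ ℤ}`. -/
def grid : Set ℝ := Set.range fun i : ℤ => (2 : ℝ) ^ i

open Classical in
/-- The learning rates that are active in round `t ≥ 1`. Quotients `b_s B_{s-1} / B_s` with
`B_s = 0` have numerator zero and count as zero. -/
def activeSet (b : ℕ → ℝ) (t : ℕ) : Set ℝ :=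
  if runMax b (t - 1) = 0 then ∅
  else grid ∩ Set.Ioc
    (1 / (2 * ((∑ s ∈ Finset.Icc 1 (t - 1), b s * (runMax b (s - 1) / runMax b s))
      + runMax b (t - 1))))
    (1 / (2 * runMax b (t - 1)))

/-- The surrogate loss `η (u - w)ᵀ g + (η (u - w)ᵀ g)²`. -/
def surrogate {d : ℕ} (η : ℝ) (w g u : Fin d → ℝ) : ℝ :=
  η * ((u - w) ⬝ᵥ g) + (η * ((u - w) ⬝ᵥ g)) ^ 2

/-- `v` minimizes `(u - c)ᵀ Λ (u - c)` over `u ∈ U`. -/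
def IsProjection {d : ℕ} (U : Set (Fin d → ℝ)) (Λ : Matrix (Fin d) (Fin d) ℝ)
    (c v : Fin d → ℝ) : Prop :=
  v ∈ U ∧ ∀ u ∈ U, (v - c) ⬝ᵥ (Λ *ᵥ (v - c)) ≤ (u - c) ⬝ᵥ (Λ *ᵥ (u - c))

/-- The minimizer of `(u - c)ᵀ Λ (u - c)` over `u ∈ U` (arbitrary if there is none). -/
def project {d : ℕ} (U : Set (Fin d → ℝ)) (Λ : Matrix (Fin d) (Fin d) ℝ)
    (c : Fin d → ℝ) : Fin d → ℝ :=
  Classical.epsilon (IsProjection U Λ c)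

/-- What an `η`-expert remembers from one round to the next: the unprojected point, the precision
matrix `Λ` and the covariance matrix `Σ`. -/
structure ExpertState (d : ℕ) where
  center : Fin d → ℝ
  prec : Matrix (Fin d) (Fin d) ℝ
  cov : Matrix (Fin d) (Fin d) ℝ

/-- The state of an expert when it is started. -/
def ExpertState.init (d : ℕ) (σ : ℝ) : ExpertState d where
  center := 0
  prec := (1 / σ ^ 2) • (1 : Matrix (Fin d) (Fin d) ℝ)
  cov := σ ^ 2 • (1 : Matrix (Fin d) (Fin d) ℝ)

/-- The expert's prediction: the projection onto the current domain `U`. -/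
def ExpertState.predict {d : ℕ} (e : ExpertState d) (U : Set (Fin d → ℝ)) : Fin d → ℝ :=
  project U e.prec e.center

/-- The expert's update of `Σ` after observing the gradient `g` (Sherman-Morrison). -/
def ExpertState.nextCov {d : ℕ} (e : ExpertState d) (η : ℝ) (g : Fin d → ℝ) :
    Matrix (Fin d) (Fin d) ℝ :=
  e.cov - (2 * η ^ 2 / (1 + 2 * η ^ 2 * (g ⬝ᵥ (e.cov *ᵥ g)))) •
    vecMulVec (e.cov *ᵥ g) (g ᵥ* e.cov)

/-- The update of the `η`-expert after a round with domain `U`, in which the controller predicted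
`w` and the gradient `g` was observed there. -/
def ExpertState.update {d : ℕ} (e : ExpertState d) (η : ℝ) (U : Set (Fin d → ℝ))
    (w g : Fin d → ℝ) : ExpertState d where
  center := e.predict U -
    ((1 + 2 * η * ((e.predict U - w) ⬝ᵥ g)) * η) • (e.nextCov η g *ᵥ g)
  prec := e.prec + (2 * η ^ 2) • vecMulVec g g
  cov := e.nextCov η g

/-- What the controller remembers: for each learning rate `η` the state of the `η`-expert and its
weight `p(η)`, and the number `τ` of the last round after which there was a reset (`0` if there
was none), so that the current epoch started in round `τ + 1`. For learning rates that have not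
been started yet, the expert's initial state and the weight `1` that it gets when it is started
are stored. -/
structure State (d : ℕ) where
  expert : ℝ → ExpertState d
  weight : ℝ → ℝ
  epoch : ℕ

/-- The controller's prediction for the active set `A` and the domain `U`. -/
def State.predict {d : ℕ} (S : State d) (A : Set ℝ) (U : Set (Fin d → ℝ)) : Fin d → ℝ :=
  open Classical in
  if A = ∅ then 0
  else (∑ᶠ η ∈ A, S.weight η * η)⁻¹ • ∑ᶠ η ∈ A, (S.weight η * η) • (S.expert η).predict U

/-- In an epoch that started in round `τ + 1`, a reset is needed after round `t`. -/
def ResetNeeded (b : ℕ → ℝ) (τ t : ℕ) : Prop :=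
  runMax b t > runMax b τ * ∑ s ∈ Finset.Icc 1 t, b s / runMax b s

/-- The clipped gradient `(B_{t-1} / B_t) g_t`. -/
def clippedGrad {d : ℕ} (g : ℕ → Fin d → ℝ) (b : ℕ → ℝ) (t : ℕ) : Fin d → ℝ :=
  (runMax b (t - 1) / runMax b t) • g t

/-- The clipped surrogate loss of the `η`-expert's prediction in round `t`, if the controller
enters that round in state `S`. -/
def State.clippedLoss {d : ℕ} (S : State d) (U : ℕ → Set (Fin d → ℝ)) (g : ℕ → Fin d → ℝ)
    (b : ℕ → ℝ) (t : ℕ) (η : ℝ) : ℝ :=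
  surrogate η (S.predict (activeSet b t) (U t)) (clippedGrad g b t) ((S.expert η).predict (U t))

open Classical in
/-- The controller's update at the end of round `t`. -/
def State.step {d : ℕ} (S : State d) (U : ℕ → Set (Fin d → ℝ)) (g : ℕ → Fin d → ℝ)
    (b : ℕ → ℝ) (t : ℕ) : State d where
  expert η :=
    if η ∈ activeSet b t then
      (S.expert η).update η (U t) (S.predict (activeSet b t) (U t)) (g t)
    else S.expert η
  weight η :=
    if η ∈ activeSet b t then
      if ResetNeeded b S.epoch t then 1
      else S.weight η * Real.exp (-S.clippedLoss U g b t η) /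
          (∑ᶠ ζ ∈ activeSet b t, S.weight ζ * Real.exp (-S.clippedLoss U g b t ζ)) *
        ∑ᶠ ζ ∈ activeSet b t, S.weight ζ
    else S.weight η
  epoch := if ResetNeeded b S.epoch t then t else S.epoch

/-- The state of MetaGrad Full after round `t`, if it is run with parameter `σ` on the domains
`U 1, U 2, …`, the gradients `g 1, g 2, …` and the range bounds `b 1, b 2, …`. It is a function of
the domains, gradients and range bounds of the rounds `1, …, t` only. -/
def state {d : ℕ} (σ : ℝ) (U : ℕ → Set (Fin d → ℝ)) (g : ℕ → Fin d → ℝ) (b : ℕ → ℝ) :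
    ℕ → State d
  | 0 => { expert := fun _ => ExpertState.init d σ, weight := fun _ => 1, epoch := 0 }
  | t + 1 => (state σ U g b t).step U g b (t + 1)

/-- The prediction `w_t` of MetaGrad Full in round `t ≥ 1`. It depends on the gradients and range
bounds of the rounds `1, …, t - 1` and the domains of the rounds `1, …, t` only. -/
def prediction {d : ℕ} (σ : ℝ) (U : ℕ → Set (Fin d → ℝ)) (g : ℕ → Fin d → ℝ) (b : ℕ → ℝ)
    (t : ℕ) : Fin d → ℝ :=
  (state σ U g b (t - 1)).predict (activeSet b t) (U t)

/-- In round `t`, all projections of active experts onto the domain exist. This holds in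
particular if the domain is closed, as the precision matrices are positive definite. -/
def ProjectionsExist {d : ℕ} (σ : ℝ) (U : ℕ → Set (Fin d → ℝ)) (g : ℕ → Fin d → ℝ)
    (b : ℕ → ℝ) (t : ℕ) : Prop :=
  ∀ η ∈ activeSet b t, ∃ v, IsProjection (U t)
    ((state σ U g b (t - 1)).expert η).prec ((state σ U g b (t - 1)).expert η).center v

/-- The linearized regret `∑_{t ≤ T} (w_t - u)ᵀ g_t`. -/
def linRegret {d : ℕ} (w g : ℕ → Fin d → ℝ) (u : Fin d → ℝ) (T : ℕ) : ℝ :=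
  ∑ t ∈ Finset.Icc 1 T, (w t - u) ⬝ᵥ g t

/-- The variance `V_T^u = ∑_{t ≤ T} ((u - w_t)ᵀ g_t)²`. -/
def variance {d : ℕ} (w g : ℕ → Fin d → ℝ) (u : Fin d → ℝ) (T : ℕ) : ℝ :=
  ∑ t ∈ Finset.Icc 1 T, ((u - w t) ⬝ᵥ g t) ^ 2

/-- The gradient covariance matrix `F_T = ∑_{t ≤ T} g_t g_tᵀ`. -/
def gradCov {d : ℕ} (g : ℕ → Fin d → ℝ) (T : ℕ) : Matrix (Fin d) (Fin d) ℝ :=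
  ∑ t ∈ Finset.Icc 1 T, vecMulVec (g t) (g t)

/-- The sum `∑_{t ≤ T} ‖g_t‖₂²`. -/
def gradSq {d : ℕ} (g : ℕ → Fin d → ℝ) (T : ℕ) : ℝ :=
  ∑ t ∈ Finset.Icc 1 T, sqNorm (g t)

/-- The smallest integer that is at least `z` and at least `1`. -/
def ceilPos (z : ℝ) : ℤ := max ⌈z⌉ 1

/-- `Z'_T = 2 ln ⌈2 log₂ T⌉₊ + 1/2`. -/
def Z' (T : ℕ) : ℝ := 2 * Real.log (ceilPos (2 * Real.logb 2 T)) + 1 / 2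

/-- `Z_T = rk(F_T) ln(1 + σ² ∑ ‖g_t‖² / (2 B_T² rk(F_T))) + 2 ln ⌈2 log₂ T⌉₊ + 1/2`, where the first
term is zero if `rk(F_T) = 0`. -/
def Z {d : ℕ} (σ : ℝ) (g : ℕ → Fin d → ℝ) (b : ℕ → ℝ) (T : ℕ) : ℝ :=
  ((gradCov g T).rank : ℝ) *
      Real.log (1 + σ ^ 2 * gradSq g T / (2 * runMax b T ^ 2 * ((gradCov g T).rank : ℝ)))
    + 2 * Real.log (ceilPos (2 * Real.logb 2 T)) + 1 / 2

end

end MetaGrad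

namespace MetaGrad

open Matrix

/-! ### Scalar inequalities -/

/-! Fix η in the grid with 2ηB_T ≤ 1. Then ηR − η²V = −∑ ℓ_t^η(u), and writing −ℓ(u) = (ℓ(w^η) −
ℓ(u)) − ℓ(w^η) splits this into the regret of the η-expert and the regret of the controller against
that expert.

The expert makes online Newton steps. In each one the potential `distSq` / 2 pays for the regret up
to 2η² gᵀΣ'g, with Σ' the updated covariance (`Regular.surrogate_sub_le`). This excess is at most an
increment of log det Λ, and also at most 2η²σ²‖g‖²; the two claimed bounds differ only here.

For the controller, exp(−x − x²) ≤ 1 − x and the choice of w_t as a weighted mean keep the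
unnormalized total weight from growing (`sum_weight_mul_exp_le`). In one epoch the relevant rates
form a dyadic grid whose endpoints have ratio at most T², so no expert gains more than ln⌈2 log₂ T⌉₊
(`gain_epoch_le`). The reset rule makes the ranges before the last two epochs sum to at most B_T
(`exists_early`), so only two such logarithms remain. Clipping costs another ηB_T by telescoping,
and rounds in which η is inactive cost at most 1/2 (`sum_inactive_le`). `regret_le_of_mem_grid` adds
this up, and `le_of_forall_mem_grid` chooses η. -/

lemma exp_neg_add_sq_le {x : ℝ} (h : |x| ≤ 1 / 2) : Real.exp (-(x + x ^ 2)) ≤ 1 - x := by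
  obtain ⟨h1, h2⟩ := abs_le.1 h
  have hpos : 0 < 1 - x := by linarith
  suffices 1 ≤ (1 - x) * Real.exp (x + x ^ 2) by
    rw [Real.exp_neg]
    exact (inv_le_iff_one_le_mul₀ (Real.exp_pos _)).2 this
  rcases le_total 0 x with hx | hx
  -- The second-order bound is needed: (1 - x)(1 + y + y²/2) with y = x + x² equals 1 + x²(1 - x -
  -- x² - x³)/2.
  · have := Real.quadratic_le_exp_of_nonneg (x := x + x ^ 2) (by positivity)
    have hp : 0 ≤ x ^ 2 * (1 - x - x ^ 2 - x ^ 3) := by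
      refine mul_nonneg (sq_nonneg x) ?_
      have : x ^ 2 ≤ 1 / 4 := by nlinarith
      have : x ^ 3 ≤ 1 / 8 := by nlinarith
      linarith
    nlinarith [mul_le_mul_of_nonneg_left this hpos.le]
  -- First order suffices here, as (1 - x)(1 + x + x²) = 1 - x³.
  · have := Real.add_one_le_exp (x + x ^ 2)
    have h3 : 0 ≤ -x * x ^ 2 := mul_nonneg (by linarith) (sq_nonneg x)
    nlinarith [mul_le_mul_of_nonneg_left this hpos.le]

/-! ### Running maxima -/

lemma runMax_mono (b : ℕ → ℝ) : Monotone (runMax b) :=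
  monotone_nat_of_le_succ fun _ => le_max_left _ _

lemma runMax_nonneg (b : ℕ → ℝ) (t : ℕ) : 0 ≤ runMax b t := runMax_mono b (Nat.zero_le t)

lemma le_runMax (b : ℕ → ℝ) {t : ℕ} (ht : 1 ≤ t) : b t ≤ runMax b t := by
  obtain ⟨s, rfl⟩ := Nat.exists_eq_add_of_le' ht
  exact le_max_right _ _

/-- The clipping factor `B_{t-1} / B_t`. -/
noncomputable def clip (b : ℕ → ℝ) (t : ℕ) : ℝ := runMax b (t - 1) / runMax b t

lemma clip_nonneg (b : ℕ → ℝ) (t : ℕ) : 0 ≤ clip b t :=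
  div_nonneg (runMax_nonneg b _) (runMax_nonneg b _)

lemma clip_le_one (b : ℕ → ℝ) (t : ℕ) : clip b t ≤ 1 :=
  div_le_one_of_le₀ (runMax_mono b (Nat.sub_le t 1)) (runMax_nonneg b _)

lemma mul_clip_le (b : ℕ → ℝ) {t : ℕ} (ht : 1 ≤ t) : b t * clip b t ≤ runMax b (t - 1) := by
  rcases (runMax_nonneg b t).eq_or_lt with h | h
  · simpa [clip, ← h] using runMax_nonneg b (t - 1)
  · rw [clip, mul_div_assoc', div_le_iff₀ h, mul_comm]
    exact mul_le_mul_of_nonneg_left (le_runMax b ht) (runMax_nonneg b _)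

lemma mul_one_sub_clip_le (b : ℕ → ℝ) {t : ℕ} (ht : 1 ≤ t) :
    b t * (1 - clip b t) ≤ runMax b t - runMax b (t - 1) := by
  rcases (runMax_nonneg b t).eq_or_lt with h | h
  · have h0 : runMax b (t - 1) = 0 :=
      le_antisymm (h ▸ runMax_mono b (Nat.sub_le t 1)) (runMax_nonneg b _)
    have hb := le_runMax b ht
    simp only [clip, ← h, h0] at hb ⊢
    simpa using hb
  · have h1 : runMax b t * (1 - clip b t) = runMax b t - runMax b (t - 1) := by
      rw [clip]; field_simp
    rw [← h1]
    exact mul_le_mul_of_nonneg_right (le_runMax b ht) (by linarith [clip_le_one b t])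

/-- Clipping removes at most B_t - B_{t-1} in round t, and these increments telescope. -/
lemma sum_mul_one_sub_clip_le (b : ℕ → ℝ) (n : ℕ) :
    ∑ t ∈ Finset.Icc 1 n, b t * (1 - clip b t) ≤ runMax b n := by
  induction n with
  | zero => simp [runMax]
  | succ n ih =>
    rw [Finset.sum_Icc_succ_top (by omega)]
    have := mul_one_sub_clip_le b (t := n + 1) (by omega)
    simp only [Nat.add_sub_cancel] at this
    linarith

lemma div_runMax_le_one (b : ℕ → ℝ) {t : ℕ} (ht : 1 ≤ t) : b t / runMax b t ≤ 1 :=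
  div_le_one_of_le₀ (le_runMax b ht) (runMax_nonneg b t)

lemma sum_div_runMax_le (b : ℕ → ℝ) (n : ℕ) :
    ∑ t ∈ Finset.Icc 1 n, b t / runMax b t ≤ n := by
  refine (Finset.sum_le_sum fun t ht => div_runMax_le_one b (Finset.mem_Icc.1 ht).1).trans ?_
  simp

lemma div_runMax_mul (b : ℕ → ℝ) {t : ℕ} (ht : 1 ≤ t) (hb : 0 ≤ b t) :
    b t / runMax b t * runMax b t = b t := by
  rcases (runMax_nonneg b t).eq_or_lt with h | h
  · have := le_runMax b ht
    rw [← h] at this ⊢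
    simp [le_antisymm this hb]
  · exact div_mul_cancel₀ _ h.ne'

/-- The right-hand side has the form of the reset threshold, so a reset turns this into a bound on
all ranges before an epoch. -/
lemma sum_le_runMax_mul (b : ℕ → ℝ) (n : ℕ) (hb : ∀ t ∈ Finset.Icc 1 n, 0 ≤ b t) :
    ∑ t ∈ Finset.Icc 1 n, b t ≤ runMax b n * ∑ t ∈ Finset.Icc 1 n, b t / runMax b t := by
  rw [Finset.mul_sum]
  refine Finset.sum_le_sum fun t ht => ?_
  obtain ⟨h1, h2⟩ := Finset.mem_Icc.1 ht
  have h0 : 0 ≤ b t / runMax b t := div_nonneg (hb t ht) (runMax_nonneg b t)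
  calc b t = runMax b t * (b t / runMax b t) := by rw [mul_comm, div_runMax_mul b h1 (hb t ht)]
    _ ≤ _ := mul_le_mul_of_nonneg_right (runMax_mono b h2) h0

/-! ### Dyadic grids -/

/-- The powers of two in the half-open interval `(lo, hi]`. -/
noncomputable def dyadic (lo hi : ℝ) : Finset ℝ :=
  (Finset.Ioc ⌊Real.logb 2 lo⌋ ⌊Real.logb 2 hi⌋).image fun i : ℤ => (2 : ℝ) ^ i

lemma mem_dyadic {lo hi x : ℝ} (hlo : 0 < lo) (hhi : 0 < hi) :
    x ∈ dyadic lo hi ↔ x ∈ grid ∩ Set.Ioc lo hi := by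
  have h1 (i : ℤ) : Real.logb 2 lo < i ↔ lo < (2 : ℝ) ^ i := by
    rw [Real.logb_lt_iff_lt_rpow (by norm_num) hlo, Real.rpow_intCast]
  have h2 (i : ℤ) : (i : ℝ) ≤ Real.logb 2 hi ↔ (2 : ℝ) ^ i ≤ hi := by
    rw [Real.le_logb_iff_rpow_le (by norm_num) hhi, Real.rpow_intCast]
  simp only [dyadic, grid, Finset.mem_image, Finset.mem_Ioc, Int.floor_lt, Int.le_floor, h1, h2,
    Set.mem_inter_iff, Set.mem_range, Set.mem_Ioc]
  constructor
  · rintro ⟨i, h, rfl⟩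
    exact ⟨⟨i, rfl⟩, h⟩
  · rintro ⟨⟨i, rfl⟩, h⟩
    exact ⟨i, h, rfl⟩

lemma one_le_ceilPos (z : ℝ) : (1 : ℝ) ≤ ceilPos z := by
  exact_mod_cast le_max_right ⌈z⌉ 1

/-- The exponents lie in a half-open interval of length at most 2 log₂ T, which contains at most ⌈2
log₂ T⌉ integers. -/
lemma card_dyadic_le {lo hi : ℝ} (hlo : 0 < lo) (hhi : 0 < hi) {T : ℕ} (hT : 1 ≤ T)
    (h : hi ≤ lo * T ^ 2) : ((dyadic lo hi).card : ℝ) ≤ ceilPos (2 * Real.logb 2 T) := by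
  have hlog : Real.logb 2 hi - Real.logb 2 lo ≤ 2 * Real.logb 2 T := by
    have hT' : (0 : ℝ) < T := by exact_mod_cast hT
    have := Real.logb_le_logb_of_le (b := 2) (by norm_num) hhi h
    rw [Real.logb_mul hlo.ne' (by positivity), Real.logb_pow] at this
    push_cast at this
    linarith
  have hcard : ((dyadic lo hi).card : ℤ) ≤ ceilPos (2 * Real.logb 2 T) := by
    have h1 : (dyadic lo hi).card ≤ (⌊Real.logb 2 hi⌋ - ⌊Real.logb 2 lo⌋).toNat :=
      Finset.card_image_le.trans (Int.card_Ioc _ _).le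
    have h2 : ⌊Real.logb 2 hi⌋ - ⌊Real.logb 2 lo⌋ ≤ ⌈2 * Real.logb 2 T⌉ := by
      have h3 := Int.floor_le (Real.logb 2 hi)
      have h4 := Int.lt_floor_add_one (Real.logb 2 lo)
      have h5 := Int.le_ceil (2 * Real.logb 2 T)
      have : ((⌊Real.logb 2 hi⌋ - ⌊Real.logb 2 lo⌋ : ℤ) : ℝ) < (⌈2 * Real.logb 2 T⌉ + 1 : ℤ) := by
        push_cast
        linarith
      exact Int.lt_add_one_iff.1 (by exact_mod_cast this)
    have h6 := le_max_left ⌈2 * Real.logb 2 (T : ℝ)⌉ 1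
    have h7 := le_max_right ⌈2 * Real.logb 2 (T : ℝ)⌉ 1
    simp only [ceilPos]
    omega
  exact_mod_cast hcard

lemma pos_of_mem_grid {η : ℝ} (h : η ∈ grid) : 0 < η := by
  obtain ⟨i, rfl⟩ := h
  positivity

lemma exists_mem_grid {m : ℝ} (hm : 0 < m) : ∃ η ∈ grid, m / 2 < η ∧ η ≤ m := by
  obtain ⟨i, h1, h2⟩ := exists_mem_Ico_zpow hm (one_lt_two (α := ℝ))
  refine ⟨2 ^ i, ⟨i, rfl⟩, ?_, h1⟩
  rw [zpow_add_one₀ (by norm_num)] at h2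
  linarith

/-! ### Determinants -/

lemma posSemidef_vecMulVec_self {d : ℕ} (g : Fin d → ℝ) : (vecMulVec g g).PosSemidef := by
  simpa using posSemidef_vecMulVec_self_star g

/-- The matrix determinant lemma, with the inverse supplied as S so that an expert's `cov` can be
inserted directly. -/
lemma det_add_smul_vecMulVec {d : ℕ} {P S : Matrix (Fin d) (Fin d) ℝ} (h : P * S = 1) (k : ℝ)
    (g : Fin d → ℝ) :
    (P + k • vecMulVec g g).det = P.det * (1 + k * (g ⬝ᵥ (S *ᵥ g))) := by
  have hP : IsUnit P.det := isUnit_det_of_right_inverse h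
  have hS : P⁻¹ = S := inv_eq_right_inv h
  have := det_add_replicateCol_mul_replicateRow (ι := Unit) hP (k • g) g
  rw [← vecMulVec_eq, smul_vecMulVec] at this
  rw [this, hS]
  congr 2
  rw [det_unique]
  simp [Matrix.mul_apply, dotProduct, mulVec, Finset.mul_sum, Finset.sum_mul]
  rw [Finset.sum_comm]
  refine Finset.sum_congr rfl fun i _ => Finset.sum_congr rfl fun j _ => by ring

/-- By the matrix determinant lemma each rank-one term multiplies the determinant by a factor at
least 1. This lets rounds skipped by an expert be added to its precision matrix. -/
lemma det_le_det_add_sum {d : ℕ} {P : Matrix (Fin d) (Fin d) ℝ} (hP : P.PosDef) {k : ℝ}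
    (hk : 0 ≤ k) (g : ℕ → Fin d → ℝ) (s : Finset ℕ) :
    P.det ≤ (P + k • ∑ t ∈ s, vecMulVec (g t) (g t)).det := by
  classical
  induction s using Finset.induction_on with
  | empty => simp
  | insert a s ha ih =>
    rw [Finset.sum_insert ha, add_comm (vecMulVec _ _), smul_add, ← add_assoc]
    set Q := P + k • ∑ t ∈ s, vecMulVec (g t) (g t) with hQdef
    have hQ : Q.PosDef := hP.add_posSemidef
      ((posSemidef_sum s fun t _ => posSemidef_vecMulVec_self (g t)).smul hk)
    rw [det_add_smul_vecMulVec (mul_nonsing_inv Q hQ.det_pos.ne'.isUnit)]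
    have h0 := hQ.inv.posSemidef.dotProduct_mulVec_nonneg (g a)
    simp only [star_trivial] at h0
    refine ih.trans (le_mul_of_one_le_right hQ.det_pos.le ?_)
    have := mul_nonneg hk h0
    linarith

lemma det_one_add_smul_eq_prod {d : ℕ} {F : Matrix (Fin d) (Fin d) ℝ} (hF : F.IsHermitian)
    (k : ℝ) : (1 + k • F).det = ∏ i, (1 + k * hF.eigenvalues i) := by
  have hU : (hF.eigenvectorUnitary : Matrix (Fin d) (Fin d) ℝ) *
      star (hF.eigenvectorUnitary : Matrix _ _ ℝ) = 1 :=
    Unitary.coe_mul_star_self hF.eigenvectorUnitary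
  have hU' := Unitary.coe_star_mul_self hF.eigenvectorUnitary
  have h : 1 + k • F = (hF.eigenvectorUnitary : Matrix (Fin d) (Fin d) ℝ) *
      diagonal (fun i => 1 + k * hF.eigenvalues i) * star (hF.eigenvectorUnitary : Matrix _ _ ℝ) := by
    have hd : diagonal (fun i => 1 + k * hF.eigenvalues i) =
        1 + k • diagonal (RCLike.ofReal ∘ hF.eigenvalues : Fin d → ℝ) := by
      ext i j
      by_cases hij : i = j <;> simp [hij, one_apply]
    conv_lhs => rw [hF.spectral_theorem, Unitary.conjStarAlgAut_apply]
    rw [hd, mul_add, add_mul, mul_one, hU, Matrix.mul_smul, Matrix.smul_mul]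
  rw [h, det_mul_comm, ← mul_assoc, hU', one_mul, det_diagonal]

/-- Zero eigenvalues contribute nothing. The others number `F.rank` and sum to the trace, so
Jensen's inequality for the logarithm applies to them alone. -/
lemma log_det_one_add_le {d : ℕ} {F : Matrix (Fin d) (Fin d) ℝ} (hF : F.PosSemidef) {k : ℝ}
    (hk : 0 ≤ k) :
    Real.log (1 + k • F).det ≤ F.rank * Real.log (1 + k * F.trace / F.rank) := by
  have hH := hF.isHermitian
  have hnn : ∀ i, 0 ≤ hH.eigenvalues i := hF.eigenvalues_nonneg
  have hpos (i) : 0 < 1 + k * hH.eigenvalues i := by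
    have := mul_nonneg hk (hnn i); linarith
  classical
  set s : Finset (Fin d) := Finset.univ.filter fun i => hH.eigenvalues i ≠ 0 with hs
  have hrank : F.rank = s.card := by
    rw [hH.rank_eq_card_non_zero_eigs, Fintype.card_subtype]
  have htr : F.trace = ∑ i ∈ s, hH.eigenvalues i := by
    rw [hH.trace_eq_sum_eigenvalues, hs, Finset.sum_filter_ne_zero]
    simp
  have hlog : Real.log (1 + k • F).det = ∑ i ∈ s, Real.log (1 + k * hH.eigenvalues i) := by
    rw [det_one_add_smul_eq_prod hH, Real.log_prod fun i _ => (hpos i).ne', hs, Finset.sum_filter]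
    refine Finset.sum_congr rfl fun i _ => ?_
    by_cases h : hH.eigenvalues i = 0 <;> simp [h]
  rw [hlog, htr, hrank]
  rcases s.eq_empty_or_nonempty with h0 | h0
  · simp [h0]
  have hc : (0 : ℝ) < s.card := by exact_mod_cast h0.card_pos
  have := strictConcaveOn_log_Ioi.concaveOn.le_map_sum (t := s)
    (w := fun _ => (1 : ℝ) / s.card) (p := fun i => 1 + k * hH.eigenvalues i)
    (fun _ _ => by positivity) (by simp [hc.ne']) (fun i _ => hpos i)
  simp only [smul_eq_mul, ← Finset.mul_sum, Finset.sum_add_distrib, Finset.sum_const,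
    nsmul_eq_mul, mul_one] at this
  have e : 1 / (s.card : ℝ) * (s.card + k * ∑ i ∈ s, hH.eigenvalues i) =
      1 + k * (∑ i ∈ s, hH.eigenvalues i) / s.card := by field_simp
  rw [e, one_div, inv_mul_le_iff₀ hc] at this
  exact this

/-! ### Quadratic forms -/

lemma sqNorm_nonneg {d : ℕ} (u : Fin d → ℝ) : 0 ≤ sqNorm u := by
  simpa [sqNorm] using dotProduct_star_self_nonneg u

lemma quadForm_nonneg {d : ℕ} {M : Matrix (Fin d) (Fin d) ℝ} (hM : M.PosSemidef)
    (v : Fin d → ℝ) : 0 ≤ v ⬝ᵥ (M *ᵥ v) := hM.dotProduct_mulVec_nonneg v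

lemma dotProduct_mulVec_symm {d : ℕ} {M : Matrix (Fin d) (Fin d) ℝ} (hM : Mᵀ = M)
    (x y : Fin d → ℝ) : x ⬝ᵥ (M *ᵥ y) = y ⬝ᵥ (M *ᵥ x) := by
  rw [dotProduct_mulVec, ← mulVec_transpose, hM, dotProduct_comm]

lemma dotProduct_mulVec_add_self {d : ℕ} {M : Matrix (Fin d) (Fin d) ℝ} (hM : Mᵀ = M)
    (x y : Fin d → ℝ) :
    (x + y) ⬝ᵥ (M *ᵥ (x + y)) = x ⬝ᵥ (M *ᵥ x) + 2 * (x ⬝ᵥ (M *ᵥ y)) + y ⬝ᵥ (M *ᵥ y) := by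
  rw [mulVec_add, dotProduct_add, add_dotProduct, add_dotProduct, dotProduct_mulVec_symm hM y x]
  ring

lemma dotProduct_vecMulVec_mulVec {d : ℕ} (g x y : Fin d → ℝ) :
    x ⬝ᵥ (vecMulVec g g *ᵥ y) = (x ⬝ᵥ g) * (y ⬝ᵥ g) := by
  rw [vecMulVec_mulVec, dotProduct_comm y g]
  simp [dotProduct_smul, mul_comm]

lemma IsProjection.dist_le {d : ℕ} {U : Set (Fin d → ℝ)} {P : Matrix (Fin d) (Fin d) ℝ}
    {c v u : Fin d → ℝ} (hP : P.PosDef) (hv : IsProjection U P c v) (hU : Convex ℝ U)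
    (hu : u ∈ U) : (v - u) ⬝ᵥ (P *ᵥ (v - u)) ≤ (c - u) ⬝ᵥ (P *ᵥ (c - u)) := by
  have hsymm : Pᵀ = P := hP.isHermitian.eq
  set A := (u - v) ⬝ᵥ (P *ᵥ (u - v)) with hA
  set B := (v - c) ⬝ᵥ (P *ᵥ (u - v)) with hBdef
  have hA0 : 0 ≤ A := quadForm_nonneg hP.posSemidef _
  -- First variation: moving from v towards u within the convex set cannot decrease the quadratic
  -- form.
  have key : ∀ s : ℝ, 0 ≤ s → s ≤ 1 → 0 ≤ 2 * s * B + s ^ 2 * A := by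
    intro s h0 h1
    have hmem : v + s • (u - v) ∈ U := by
      have := hU hv.1 hu (sub_nonneg.2 h1) h0 (by ring)
      convert this using 1
      rw [smul_sub, sub_smul, one_smul]; abel
    have := hv.2 _ hmem
    have e : v + s • (u - v) - c = (v - c) + s • (u - v) := by abel
    rw [e, dotProduct_mulVec_add_self hsymm, mulVec_smul, dotProduct_smul, dotProduct_smul,
      smul_dotProduct, ← hA, ← hBdef] at this
    simp only [smul_eq_mul] at this
    nlinarith
  have hB : 0 ≤ B := by
    by_contra! hneg
    have hAB : 0 < A - B := by linarith
    -- The minimizer -B / A may exceed 1, and A may vanish; this step always lies in [0, 1] and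
    -- still gives a negative value.
    have h1 := key (-B / (A - B)) (div_nonneg (by linarith) hAB.le)
      ((div_le_one hAB).2 (by linarith))
    have e : 2 * (-B / (A - B)) * B + (-B / (A - B)) ^ 2 * A =
        -(B ^ 2 * (A - 2 * B)) / (A - B) ^ 2 := by
      field_simp; ring
    rw [e] at h1
    have h2 : 0 < B ^ 2 * (A - 2 * B) := mul_pos (sq_pos_of_neg hneg) (by linarith)
    have h3 : -(B ^ 2 * (A - 2 * B)) / (A - B) ^ 2 < 0 :=
      div_neg_of_neg_of_pos (by linarith) (by positivity)
    linarith
  have e1 : c - u = -((v - c) + (u - v)) := by abel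
  have e2 : v - u = -(u - v) := by abel
  have hC : 0 ≤ (v - c) ⬝ᵥ (P *ᵥ (v - c)) := quadForm_nonneg hP.posSemidef _
  rw [e1, e2]
  simp only [mulVec_neg, neg_dotProduct, dotProduct_neg, neg_neg]
  rw [dotProduct_mulVec_add_self hsymm, ← hA, ← hBdef]
  linarith

lemma isProjection_project {d : ℕ} {U : Set (Fin d → ℝ)} {P : Matrix (Fin d) (Fin d) ℝ}
    {c : Fin d → ℝ} (h : ∃ v, IsProjection U P c v) : IsProjection U P c (project U P c) :=
  Classical.epsilon_spec h

/-! ### Experts -/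

namespace ExpertState

variable {d : ℕ}

/-- The invariants of an expert's state: `Λ` is positive definite with inverse `Σ`, and `Σ` is
symmetric and lies between `0` and `σ² I`. -/
structure Regular (σ : ℝ) (e : ExpertState d) : Prop where
  posDef : e.prec.PosDef
  mul_cov : e.prec * e.cov = 1
  cov_symm : e.covᵀ = e.cov
  cov_nonneg : ∀ v, 0 ≤ v ⬝ᵥ (e.cov *ᵥ v)
  cov_le : ∀ v, v ⬝ᵥ (e.cov *ᵥ v) ≤ σ ^ 2 * sqNorm v

lemma regular_init {σ : ℝ} (hσ : 0 < σ) : (init d σ).Regular σ where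
  posDef := PosDef.one.smul (by positivity)
  mul_cov := by
    have : 1 / σ ^ 2 * σ ^ 2 = 1 := by field_simp
    simp [init, smul_smul]
    field_simp
    simp
  cov_symm := by simp [init]
  cov_nonneg v := by
    have := mul_nonneg (sq_nonneg σ) (sqNorm_nonneg v)
    simpa [init, smul_mulVec, sqNorm] using this
  cov_le v := by simp [init, smul_mulVec, sqNorm]

lemma nextCov_form (e : ExpertState d) (hs : e.covᵀ = e.cov) (η : ℝ) (g v : Fin d → ℝ) :
    v ⬝ᵥ (e.nextCov η g *ᵥ v) = v ⬝ᵥ (e.cov *ᵥ v) -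
      2 * η ^ 2 / (1 + 2 * η ^ 2 * (g ⬝ᵥ (e.cov *ᵥ g))) * (v ⬝ᵥ (e.cov *ᵥ g)) ^ 2 := by
  have h : g ᵥ* e.cov = e.cov *ᵥ g := by rw [← mulVec_transpose, hs]
  rw [nextCov, h, sub_mulVec, smul_mulVec, dotProduct_sub, dotProduct_smul,
    dotProduct_vecMulVec_mulVec, smul_eq_mul]
  ring

lemma Regular.one_add_pos {σ : ℝ} {e : ExpertState d} (h : e.Regular σ) (η : ℝ)
    (g : Fin d → ℝ) : 0 < 1 + 2 * η ^ 2 * (g ⬝ᵥ (e.cov *ᵥ g)) := by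
  have := mul_nonneg (by positivity : 0 ≤ 2 * η ^ 2) (h.cov_nonneg g)
  linarith

lemma Regular.nextCov_self {σ : ℝ} {e : ExpertState d} (h : e.Regular σ) (η : ℝ)
    (g : Fin d → ℝ) : g ⬝ᵥ (e.nextCov η g *ᵥ g) =
      g ⬝ᵥ (e.cov *ᵥ g) / (1 + 2 * η ^ 2 * (g ⬝ᵥ (e.cov *ᵥ g))) := by
  have h1 := (h.one_add_pos η g).ne'
  rw [e.nextCov_form h.cov_symm]
  rw [eq_div_iff h1, sub_mul, mul_right_comm (2 * η ^ 2 / _), div_mul_cancel₀ _ h1]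
  ring

/-- The Sherman-Morrison identity, which keeps Σ the inverse of Λ. -/
lemma Regular.mul_nextCov {σ : ℝ} {e : ExpertState d} (h : e.Regular σ) (η : ℝ)
    (g : Fin d → ℝ) : (e.prec + (2 * η ^ 2) • vecMulVec g g) * e.nextCov η g = 1 := by
  have h1 := (h.one_add_pos η g).ne'
  have hg : e.prec *ᵥ (e.cov *ᵥ g) = g := by rw [mulVec_mulVec, h.mul_cov, one_mulVec]
  rw [nextCov, add_mul, mul_sub, mul_sub, h.mul_cov, Matrix.mul_smul, Matrix.mul_smul,
    Matrix.smul_mul, Matrix.smul_mul, mul_vecMulVec, hg, vecMulVec_mul, vecMulVec_mul_vecMulVec,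
    vecMulVec_smul, smul_smul, smul_smul, sub_add_eq_add_sub, add_sub_assoc, sub_sub, ← add_smul,
    ← sub_smul]
  convert add_zero _
  convert zero_smul ℝ _
  field_simp
  ring

lemma Regular.update {σ : ℝ} {e : ExpertState d} (h : e.Regular σ) (η : ℝ)
    (U : Set (Fin d → ℝ)) (w g : Fin d → ℝ) : (e.update η U w g).Regular σ where
  posDef := h.posDef.add_posSemidef ((posSemidef_vecMulVec_self g).smul (by positivity))
  mul_cov := h.mul_nextCov η g
  cov_symm := by
    have hg : g ᵥ* e.cov = e.cov *ᵥ g := by rw [← mulVec_transpose, h.cov_symm]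
    simp [ExpertState.update, nextCov, hg, h.cov_symm]
  cov_nonneg v := by
    have hP : (e.prec + (2 * η ^ 2) • vecMulVec g g).PosDef :=
      h.posDef.add_posSemidef ((posSemidef_vecMulVec_self g).smul (by positivity))
    have := hP.inv.posSemidef.dotProduct_mulVec_nonneg v
    rw [inv_eq_right_inv (h.mul_nextCov η g)] at this
    simpa [ExpertState.update] using this
  cov_le v := by
    refine le_trans ?_ (h.cov_le v)
    have := h.one_add_pos η g
    simp only [ExpertState.update]
    rw [e.nextCov_form h.cov_symm]
    have : 0 ≤ 2 * η ^ 2 / (1 + 2 * η ^ 2 * (g ⬝ᵥ (e.cov *ᵥ g))) * (v ⬝ᵥ (e.cov *ᵥ g)) ^ 2 := by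
      positivity
    linarith

/-- The squared distance of `u` to the unprojected point of an expert. -/
noncomputable def distSq (e : ExpertState d) (u : Fin d → ℝ) : ℝ :=
  (e.center - u) ⬝ᵥ (e.prec *ᵥ (e.center - u))

lemma Regular.distSq_nonneg {σ : ℝ} {e : ExpertState d} (h : e.Regular σ) (u : Fin d → ℝ) :
    0 ≤ e.distSq u :=
  quadForm_nonneg h.posDef.posSemidef _

lemma distSq_init (σ : ℝ) (u : Fin d → ℝ) : (init d σ).distSq u = 1 / σ ^ 2 * sqNorm u := by
  simp [distSq, init, smul_mulVec, sqNorm]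

/-- The exact change of the distance in an online Newton step. -/
lemma Regular.surrogate_sub_eq {σ : ℝ} {e : ExpertState d} (h : e.Regular σ) (η : ℝ)
    (U : Set (Fin d → ℝ)) (w g u : Fin d → ℝ) :
    surrogate η w g (e.predict U) - surrogate η w g u =
      1 / 2 * ((e.predict U - u) ⬝ᵥ (e.prec *ᵥ (e.predict U - u)))
        - 1 / 2 * (e.update η U w g).distSq u
        + 1 / 2 * η ^ 2 * (1 + 2 * η * ((e.predict U - w) ⬝ᵥ g)) ^ 2 *
          (g ⬝ᵥ (e.nextCov η g *ᵥ g)) := by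
  have hr := h.update η U w g
  set v := e.predict U
  set k := (1 + 2 * η * ((v - w) ⬝ᵥ g)) * η with hk
  set P := e.prec + (2 * η ^ 2) • vecMulVec g g with hP
  set S := e.nextCov η g
  have hPS : P * S = 1 := h.mul_nextCov η g
  have hPs : Pᵀ = P := hr.posDef.isHermitian.eq
  have hd : (e.update η U w g).distSq u =
      ((v - u) + (-k) • (S *ᵥ g)) ⬝ᵥ (P *ᵥ ((v - u) + (-k) • (S *ᵥ g))) := by
    have : (e.update η U w g).center - u = (v - u) + (-k) • (S *ᵥ g) := by
      change v - k • (S *ᵥ g) - u = _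
      rw [neg_smul]; abel
    rw [distSq, this]
    rfl
  have hSg : P *ᵥ (S *ᵥ g) = g := by rw [mulVec_mulVec, hPS, one_mulVec]
  have hvu : (v - u) ⬝ᵥ (P *ᵥ (v - u)) =
      (v - u) ⬝ᵥ (e.prec *ᵥ (v - u)) + 2 * η ^ 2 * ((v - u) ⬝ᵥ g) ^ 2 := by
    rw [hP, add_mulVec, smul_mulVec, dotProduct_add, dotProduct_smul,
      dotProduct_vecMulVec_mulVec, smul_eq_mul, sq ((v - u) ⬝ᵥ g)]
  have hu : (u - w) ⬝ᵥ g = (v - w) ⬝ᵥ g - (v - u) ⬝ᵥ g := by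
    rw [← sub_dotProduct]
    congr 1; abel
  rw [hd, dotProduct_mulVec_add_self hPs, mulVec_smul, hSg, dotProduct_smul, dotProduct_smul,
    smul_dotProduct, dotProduct_comm (S *ᵥ g) g, hvu, surrogate, surrogate, hu, hk]
  simp only [smul_eq_mul]
  ring

/-- The regret of an online Newton step with respect to the surrogate loss. -/
lemma Regular.surrogate_sub_le {σ : ℝ} {e : ExpertState d} (h : e.Regular σ) {η : ℝ}
    {U : Set (Fin d → ℝ)} {w g u : Fin d → ℝ} (hU : Convex ℝ U) (hu : u ∈ U)
    (hp : ∃ v, IsProjection U e.prec e.center v)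
    (hx : |η * ((e.predict U - w) ⬝ᵥ g)| ≤ 1 / 2) :
    surrogate η w g (e.predict U) - surrogate η w g u ≤
      1 / 2 * e.distSq u - 1 / 2 * (e.update η U w g).distSq u
        + 2 * η ^ 2 * (g ⬝ᵥ (e.nextCov η g *ᵥ g)) := by
  rw [h.surrogate_sub_eq]
  have h1 := (isProjection_project hp).dist_le h.posDef hU hu
  have h2 : 0 ≤ g ⬝ᵥ (e.nextCov η g *ᵥ g) := (h.update η U w g).cov_nonneg g
  -- The factor lies in [0, 2], which turns the coefficient 1/2 of the exact identity into 2.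
  have h3 : (1 + 2 * η * ((e.predict U - w) ⬝ᵥ g)) ^ 2 ≤ 4 := by
    obtain ⟨h4, h5⟩ := abs_le.1 hx
    nlinarith
  have h4 := mul_le_mul_of_nonneg_right h3
    (mul_nonneg (by positivity : 0 ≤ 1 / 2 * η ^ 2) h2)
  change 1 / 2 * ((e.predict U - u) ⬝ᵥ (e.prec *ᵥ (e.predict U - u))) - _ + _ ≤ _
  have h5 : (e.predict U - u) ⬝ᵥ (e.prec *ᵥ (e.predict U - u)) ≤ e.distSq u := h1
  linarith

lemma Regular.nextCov_le_sqNorm {σ : ℝ} {e : ExpertState d} (h : e.Regular σ) (η : ℝ)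
    (g : Fin d → ℝ) : g ⬝ᵥ (e.nextCov η g *ᵥ g) ≤ σ ^ 2 * sqNorm g :=
  -- The updated covariance depends on neither the domain nor the controller's prediction, so any
  -- values serve.
  (h.update η ∅ 0 g).cov_le g

/-- With x = 2η² gᵀΣg the left side is x / (1 + x) = 1 - 1 / (1 + x) ≤ ln(1 + x), and 1 + x is the
growth factor of det Λ. -/
lemma Regular.nextCov_le_log_det {σ : ℝ} {e : ExpertState d} (h : e.Regular σ) (η : ℝ)
    (U : Set (Fin d → ℝ)) (w g : Fin d → ℝ) : 2 * η ^ 2 * (g ⬝ᵥ (e.nextCov η g *ᵥ g)) ≤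
      Real.log (e.update η U w g).prec.det - Real.log e.prec.det := by
  have h1 := h.one_add_pos η g
  have hdet : (e.update η U w g).prec.det =
      e.prec.det * (1 + 2 * η ^ 2 * (g ⬝ᵥ (e.cov *ᵥ g))) :=
    det_add_smul_vecMulVec h.mul_cov _ _
  rw [hdet, Real.log_mul h.posDef.det_pos.ne' h1.ne', h.nextCov_self, add_sub_cancel_left]
  refine le_trans (le_of_eq ?_) (Real.one_sub_inv_le_log_of_pos h1)
  field_simp
  ring

end ExpertState

/-- The standing assumptions on the input of MetaGrad Full in the first `T` rounds. -/
structure Admissible {d : ℕ} (σ : ℝ) (U : ℕ → Set (Fin d → ℝ)) (g : ℕ → Fin d → ℝ) (b : ℕ → ℝ)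
    (T : ℕ) : Prop where
  pos : 0 < σ
  convex : ∀ t ∈ Finset.Icc 1 T, Convex ℝ (U t)
  zero_mem : ∀ t ∈ Finset.Icc 1 T, (0 : Fin d → ℝ) ∈ U t
  projections : ∀ t ∈ Finset.Icc 1 T, ProjectionsExist σ U g b t
  bound : ∀ t ∈ Finset.Icc 1 T, ∀ v ∈ U t, |(v - prediction σ U g b t) ⬝ᵥ g t| ≤ b t

lemma sum_Icc_split {M : Type*} [AddCommMonoid M] (f : ℕ → M) {a m n : ℕ} (ham : a ≤ m + 1)
    (hmn : m ≤ n) :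
    ∑ t ∈ Finset.Icc a n, f t = ∑ t ∈ Finset.Icc a m, f t + ∑ t ∈ Finset.Icc (m + 1) n, f t := by
  induction n, hmn using Nat.le_induction with
  | base => simp
  | succ n hmn ih =>
    rw [Finset.sum_Icc_succ_top (by omega), ih, Finset.sum_Icc_succ_top (by omega), add_assoc]

/-! ### Active sets -/

/-- Half the inverse of the smallest learning rate that has been active up to round `n + 1`. -/
noncomputable def horizon (b : ℕ → ℝ) (n : ℕ) : ℝ :=
  ∑ s ∈ Finset.Icc 1 n, b s * clip b s + runMax b n

lemma horizon_mono (b : ℕ → ℝ) {m n : ℕ} (hmn : m ≤ n) (hb : ∀ t ∈ Finset.Icc 1 n, 0 ≤ b t) :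
    horizon b m ≤ horizon b n := by
  refine add_le_add (Finset.sum_le_sum_of_subset_of_nonneg
    (Finset.Icc_subset_Icc_right hmn) fun t ht _ => ?_) (runMax_mono b hmn)
  exact mul_nonneg (hb t ht) (clip_nonneg b t)

lemma runMax_le_horizon (b : ℕ → ℝ) {n : ℕ} (hb : ∀ t ∈ Finset.Icc 1 n, 0 ≤ b t) :
    runMax b n ≤ horizon b n :=
  le_add_of_nonneg_left (Finset.sum_nonneg fun t ht => mul_nonneg (hb t ht) (clip_nonneg b t))

lemma horizon_le (b : ℕ → ℝ) (n : ℕ) :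
    horizon b n ≤ runMax b n * (n + 1) := by
  have h : ∑ s ∈ Finset.Icc 1 n, b s * clip b s ≤ ∑ s ∈ Finset.Icc 1 n, runMax b n :=
    Finset.sum_le_sum fun s hs =>
      (mul_clip_le b (Finset.mem_Icc.1 hs).1).trans
        (runMax_mono b ((Nat.sub_le _ _).trans (Finset.mem_Icc.1 hs).2))
  simp only [Finset.sum_const, Nat.card_Icc, Nat.add_sub_cancel, nsmul_eq_mul] at h
  rw [horizon]
  linarith

lemma mem_activeSet (b : ℕ → ℝ) {n : ℕ} (hb : ∀ t ∈ Finset.Icc 1 n, 0 ≤ b t) {η : ℝ} :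
    η ∈ activeSet b (n + 1) ↔
      η ∈ grid ∧ 0 < runMax b n ∧ 1 < 2 * η * horizon b n ∧ 2 * η * runMax b n ≤ 1 := by
  unfold activeSet
  simp only [Nat.add_sub_cancel]
  change η ∈ (if runMax b n = 0 then (∅ : Set ℝ) else grid ∩ Set.Ioc (1 / (2 * horizon b n)) _) ↔ _
  split_ifs with h
  · simp [h]
  · have h0 : 0 < runMax b n := lt_of_le_of_ne (runMax_nonneg b n) (Ne.symm h)
    have h1 : 0 < horizon b n := h0.trans_le (runMax_le_horizon b hb)
    rw [Set.mem_inter_iff, Set.mem_Ioc, div_lt_iff₀ (by positivity), le_div_iff₀ (by positivity)]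
    simp only [h0, true_and, and_congr_right_iff]
    intro _
    rw [show η * (2 * horizon b n) = 2 * η * horizon b n by ring,
      show η * (2 * runMax b n) = 2 * η * runMax b n by ring]

lemma exists_finset_activeSet (b : ℕ → ℝ) {n : ℕ} (hb : ∀ t ∈ Finset.Icc 1 n, 0 ≤ b t) :
    ∃ A : Finset ℝ, (A : Set ℝ) = activeSet b (n + 1) := by
  by_cases h : runMax b n = 0
  · exact ⟨∅, by simp [activeSet, h]⟩
  · have h0 : 0 < runMax b n := lt_of_le_of_ne (runMax_nonneg b n) (Ne.symm h)
    have h1 : 0 < horizon b n := h0.trans_le (runMax_le_horizon b hb)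
    refine ⟨dyadic (1 / (2 * horizon b n)) (1 / (2 * runMax b n)), ?_⟩
    ext η
    rw [Finset.mem_coe, mem_dyadic (by positivity) (by positivity), activeSet,
      Nat.add_sub_cancel, if_neg h]
    rfl

/-- A learning rate that is small enough to be active, but is not, has never been active. -/
lemma notMem_activeSet_of_le (b : ℕ → ℝ) {n : ℕ} (hb : ∀ t ∈ Finset.Icc 1 n, 0 ≤ b t) {η : ℝ}
    (hη : 2 * η * runMax b n ≤ 1) (h : η ∉ activeSet b (n + 1)) {m : ℕ} (hm : m ≤ n) :
    η ∉ activeSet b (m + 1) := by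
  intro hmem
  have hb' : ∀ t ∈ Finset.Icc 1 m, 0 ≤ b t := fun t ht =>
    hb t (Finset.Icc_subset_Icc_right hm ht)
  obtain ⟨h1, h2, h3, -⟩ := (mem_activeSet b hb').1 hmem
  refine h ((mem_activeSet b hb).2 ⟨h1, h2.trans_le (runMax_mono b hm), h3.trans_le ?_, hη⟩)
  exact mul_le_mul_of_nonneg_left (horizon_mono b hm hb)
    (by have := pos_of_mem_grid h1; positivity)

/-- The loss that can be incurred in rounds in which a given learning rate is not yet active. -/
lemma sum_inactive_le (b : ℕ → ℝ) {T : ℕ} (hb : ∀ t ∈ Finset.Icc 1 T, 0 ≤ b t) {η : ℝ}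
    (hη : η ∈ grid) (hηB : 2 * η * runMax b T ≤ 1) {n : ℕ} (hn : n ≤ T) :
    η * ∑ t ∈ Finset.Icc 1 n,
      (open Classical in if η ∈ activeSet b t then 0 else b t * clip b t) ≤ 1 / 2 := by
  have hη0 := pos_of_mem_grid hη
  induction n with
  | zero => simp
  | succ n ih =>
    have hb' : ∀ t ∈ Finset.Icc 1 n, 0 ≤ b t := fun t ht =>
      hb t (Finset.Icc_subset_Icc_right (by omega) ht)
    rw [Finset.sum_Icc_succ_top (by omega)]
    by_cases h : η ∈ activeSet b (n + 1)
    · rw [if_pos h, add_zero]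
      exact ih (by omega)
    · rw [if_neg h]
      have h1 : ∑ t ∈ Finset.Icc 1 n,
          (open Classical in if η ∈ activeSet b t then 0 else b t * clip b t) ≤
          ∑ t ∈ Finset.Icc 1 n, b t * clip b t := by
        refine Finset.sum_le_sum fun t ht => ?_
        split_ifs
        · exact mul_nonneg (hb' t ht) (clip_nonneg b t)
        · exact le_rfl
      have h2 := mul_clip_le b (t := n + 1) (by omega)
      rw [Nat.add_sub_cancel] at h2
      -- An inactive round n + 1 bounds its whole past: all clipped ranges up to n, plus B_n for the
      -- round itself, make up `horizon b n`, and a rate below the upper end of the active interval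
      -- is inactive only if 2η `horizon b n` ≤ 1 or B_n = 0.
      refine (mul_le_mul_of_nonneg_left (add_le_add h1 h2) hη0.le).trans ?_
      change η * horizon b n ≤ 1 / 2
      have h3 : 2 * η * runMax b n ≤ 1 := (mul_le_mul_of_nonneg_left
        (runMax_mono b (by omega : n ≤ T)) (by positivity)).trans hηB
      by_contra! h4
      rcases (runMax_nonneg b n).eq_or_lt with h0 | h0
      · have := horizon_le b n
        rw [← h0, zero_mul] at this
        have := mul_nonpos_of_nonneg_of_nonpos hη0.le this
        linarith
      · exact h ((mem_activeSet b hb').2 ⟨hη, h0, by linarith, h3⟩)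

section Trajectory

variable {d : ℕ} {σ : ℝ} {U : ℕ → Set (Fin d → ℝ)} {g : ℕ → Fin d → ℝ} {b : ℕ → ℝ} {T : ℕ}

lemma Admissible.nonneg (h : Admissible σ U g b T) : ∀ t ∈ Finset.Icc 1 T, 0 ≤ b t :=
  fun t ht => (abs_nonneg _).trans (h.bound t ht 0 (h.zero_mem t ht))

lemma Admissible.nonneg_of_le (h : Admissible σ U g b T) {n : ℕ} (hn : n ≤ T) :
    ∀ t ∈ Finset.Icc 1 n, 0 ≤ b t :=
  fun t ht => h.nonneg t (Finset.Icc_subset_Icc_right hn ht)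

/-! ### Experts along a run -/

open Classical in
lemma expert_succ (n : ℕ) (η : ℝ) : (state σ U g b (n + 1)).expert η =
    if η ∈ activeSet b (n + 1) then ((state σ U g b n).expert η).update η (U (n + 1))
      (prediction σ U g b (n + 1)) (g (n + 1))
    else (state σ U g b n).expert η := rfl

lemma regular_expert (hσ : 0 < σ) (n : ℕ) (η : ℝ) :
    ((state σ U g b n).expert η).Regular σ := by
  induction n with
  | zero => exact ExpertState.regular_init hσ
  | succ n ih =>
    rw [expert_succ]
    split_ifs
    · exact ih.update _ _ _ _
    · exact ih

variable (σ U g b) in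
/-- The prediction of the `η`-expert in round `t`. -/
noncomputable def expertPrediction (η : ℝ) (t : ℕ) : Fin d → ℝ :=
  ((state σ U g b (t - 1)).expert η).predict (U t)

lemma Admissible.expertPrediction_mem (h : Admissible σ U g b T) {t : ℕ}
    (ht : t ∈ Finset.Icc 1 T) {η : ℝ} (hη : η ∈ activeSet b t) :
    expertPrediction σ U g b η t ∈ U t :=
  (isProjection_project (h.projections t ht η hη)).1

lemma Admissible.abs_expert_le (h : Admissible σ U g b T) {t : ℕ}
    (ht : t ∈ Finset.Icc 1 T) {η : ℝ} (hη : η ∈ activeSet b t) :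
    |(expertPrediction σ U g b η t - prediction σ U g b t) ⬝ᵥ g t| ≤ b t :=
  h.bound t ht _ (h.expertPrediction_mem ht hη)

variable (σ U g b) in
open Classical in
/-- The regret of the `η`-expert in the rounds up to `n` in which it is active. -/
noncomputable def expertRegret (η : ℝ) (u : Fin d → ℝ) (n : ℕ) : ℝ :=
  ∑ t ∈ Finset.Icc 1 n, if η ∈ activeSet b t then
    surrogate η (prediction σ U g b t) (g t) (expertPrediction σ U g b η t) -
      surrogate η (prediction σ U g b t) (g t) u else 0

/-- Experts learn from unclipped gradients, so activity (2ηB_{t-1} ≤ 1) is not enough to control the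
step; `hηB` supplies 2ηb_t ≤ 1. -/
lemma Admissible.expert_round (h : Admissible σ U g b T) {η : ℝ} (hη0 : 0 < η)
    (hηB : 2 * η * runMax b T ≤ 1) {u : Fin d → ℝ} (hu : ∀ t ∈ Finset.Icc 1 T, u ∈ U t) {n : ℕ}
    (hn : n + 1 ≤ T) (hA : η ∈ activeSet b (n + 1)) :
    surrogate η (prediction σ U g b (n + 1)) (g (n + 1)) (expertPrediction σ U g b η (n + 1)) -
      surrogate η (prediction σ U g b (n + 1)) (g (n + 1)) u ≤
      1 / 2 * ((state σ U g b n).expert η).distSq u -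
        1 / 2 * ((state σ U g b (n + 1)).expert η).distSq u +
        2 * η ^ 2 * (g (n + 1) ⬝ᵥ (((state σ U g b n).expert η).nextCov η (g (n + 1)) *ᵥ
          g (n + 1))) := by
  have ht : n + 1 ∈ Finset.Icc 1 T := Finset.mem_Icc.2 ⟨by omega, hn⟩
  rw [expert_succ, if_pos hA]
  refine (regular_expert h.pos n η).surrogate_sub_le (h.convex _ ht) (hu _ ht)
    (h.projections _ ht η hA) ?_
  rw [abs_mul, abs_of_pos hη0]
  have h1 : |(expertPrediction σ U g b η (n + 1) - prediction σ U g b (n + 1)) ⬝ᵥ g (n + 1)| ≤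
      runMax b T :=
    (h.abs_expert_le ht hA).trans ((le_runMax b (by omega)).trans (runMax_mono b hn))
  have := mul_le_mul_of_nonneg_left h1 hη0.le
  refine le_trans this ?_
  linarith

/-- Telescoping of `distSq` / 2, which starts at ‖u‖² / (2σ²) and stays nonnegative; an inactive
expert keeps its state. -/
lemma Admissible.expertRegret_le_gradSq (h : Admissible σ U g b T) {η : ℝ} (hη0 : 0 < η)
    (hηB : 2 * η * runMax b T ≤ 1) {u : Fin d → ℝ} (hu : ∀ t ∈ Finset.Icc 1 T, u ∈ U t) :
    expertRegret σ U g b η u T ≤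
      1 / (2 * σ ^ 2) * sqNorm u + 2 * η ^ 2 * σ ^ 2 * gradSq g T := by
  have key : ∀ n ≤ T, expertRegret σ U g b η u n ≤ 1 / (2 * σ ^ 2) * sqNorm u -
      1 / 2 * ((state σ U g b n).expert η).distSq u + 2 * η ^ 2 * σ ^ 2 * gradSq g n := by
    intro n hn
    induction n with
    | zero =>
      simp only [expertRegret, gradSq, state, ExpertState.distSq_init]
      refine le_of_eq ?_
      simp
      ring
    | succ n ih =>
      have ih := ih (by omega)
      have hg := mul_nonneg (by positivity : 0 ≤ 2 * η ^ 2 * σ ^ 2) (sqNorm_nonneg (g (n + 1)))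
      rw [expertRegret, gradSq, Finset.sum_Icc_succ_top (by omega),
        Finset.sum_Icc_succ_top (by omega)]
      change expertRegret σ U g b η u n + _ ≤ _ - _ + _ * (gradSq g n + _)
      by_cases hA : η ∈ activeSet b (n + 1)
      · have h1 := h.expert_round hη0 hηB hu hn hA
        have h2 := mul_le_mul_of_nonneg_left
          ((regular_expert (U := U) (g := g) (b := b) h.pos n η).nextCov_le_sqNorm η (g (n + 1)))
          (by positivity : 0 ≤ 2 * η ^ 2)
        rw [if_pos hA]
        linarith
      · rw [if_neg hA, expert_succ, if_neg hA]
        linarith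
  have := key T le_rfl
  have := (regular_expert (U := U) (g := g) (b := b) h.pos T η).distSq_nonneg u
  linarith

lemma prec_expert (n : ℕ) (η : ℝ) : ∃ s ⊆ Finset.Icc 1 n, ((state σ U g b n).expert η).prec =
    (1 / σ ^ 2) • 1 + (2 * η ^ 2) • ∑ t ∈ s, vecMulVec (g t) (g t) := by
  classical
  induction n with
  | zero => exact ⟨∅, by simp, by simp [state, ExpertState.init]⟩
  | succ n ih =>
    obtain ⟨s, hs, hs'⟩ := ih
    have hsub : Finset.Icc 1 n ⊆ Finset.Icc 1 (n + 1) := Finset.Icc_subset_Icc_right (by omega)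
    rw [expert_succ]
    split_ifs with hA
    · refine ⟨insert (n + 1) s, ?_, ?_⟩
      · exact Finset.insert_subset (by simp) (hs.trans hsub)
      · rw [Finset.sum_insert fun hmem => by simpa using hs hmem]
        simp only [ExpertState.update, hs', smul_add]
        abel
    · exact ⟨s, hs.trans hsub, hs'⟩

lemma log_det_prec_le (hσ : 0 < σ) (n : ℕ) (η : ℝ) :
    Real.log ((state σ U g b n).expert η).prec.det ≤ Real.log (ExpertState.init d σ).prec.det +
      Real.log (1 + (2 * η ^ 2 * σ ^ 2) • gradCov g n).det := by
  classical
  obtain ⟨s, hs, hs'⟩ := prec_expert (σ := σ) (U := U) (g := g) (b := b) n η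
  have hreg := regular_expert (U := U) (g := g) (b := b) hσ n η
  have h1 : ((state σ U g b n).expert η).prec.det ≤
      ((1 / σ ^ 2) • (1 : Matrix (Fin d) (Fin d) ℝ) + (2 * η ^ 2) • gradCov g n).det := by
    -- The rounds outside s, in which the expert was not updated, are added.
    have := det_le_det_add_sum hreg.posDef (by positivity : 0 ≤ 2 * η ^ 2) g (Finset.Icc 1 n \ s)
    rwa [hs', add_assoc, ← smul_add, add_comm (∑ t ∈ s, _), Finset.sum_sdiff hs, ← hs'] at this
  have h2 : (1 / σ ^ 2) • (1 : Matrix (Fin d) (Fin d) ℝ) + (2 * η ^ 2) • gradCov g n =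
      (ExpertState.init d σ).prec * (1 + (2 * η ^ 2 * σ ^ 2) • gradCov g n) := by
    have : 1 / σ ^ 2 * (2 * η ^ 2 * σ ^ 2) = 2 * η ^ 2 := by field_simp
    simp only [ExpertState.init, smul_mul_assoc, one_mul, smul_add, smul_smul, this]
  have h3 := (ExpertState.regular_init (d := d) hσ).posDef.det_pos
  rw [h2, det_mul] at h1
  have h4 := pos_of_mul_pos_right (hreg.posDef.det_pos.trans_le h1) h3.le
  rw [← Real.log_mul h3.ne' h4.ne']
  exact Real.log_le_log hreg.posDef.det_pos h1

lemma Admissible.expertRegret_le_log_det (h : Admissible σ U g b T) {η : ℝ} (hη0 : 0 < η)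
    (hηB : 2 * η * runMax b T ≤ 1) {u : Fin d → ℝ} (hu : ∀ t ∈ Finset.Icc 1 T, u ∈ U t) :
    expertRegret σ U g b η u T ≤ 1 / (2 * σ ^ 2) * sqNorm u +
      Real.log (1 + (2 * η ^ 2 * σ ^ 2) • gradCov g T).det := by
  have key : ∀ n ≤ T, expertRegret σ U g b η u n ≤ 1 / (2 * σ ^ 2) * sqNorm u -
      1 / 2 * ((state σ U g b n).expert η).distSq u +
      (Real.log ((state σ U g b n).expert η).prec.det -
        Real.log (ExpertState.init d σ).prec.det) := by
    intro n hn
    induction n with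
    | zero =>
      simp only [expertRegret, state, ExpertState.distSq_init]
      refine le_of_eq ?_
      simp
      ring
    | succ n ih =>
      have ih := ih (by omega)
      rw [expertRegret, Finset.sum_Icc_succ_top (by omega)]
      change expertRegret σ U g b η u n + _ ≤ _
      by_cases hA : η ∈ activeSet b (n + 1)
      · have h1 := h.expert_round hη0 hηB hu hn hA
        have h2 := (regular_expert (U := U) (g := g) (b := b) h.pos n η).nextCov_le_log_det η
          (U (n + 1)) (prediction σ U g b (n + 1)) (g (n + 1))
        rw [if_pos hA]
        rw [expert_succ, if_pos hA] at h1 ⊢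
        linarith
      · rw [if_neg hA, expert_succ, if_neg hA]
        linarith
  have h1 := key T le_rfl
  have h2 := (regular_expert (U := U) (g := g) (b := b) h.pos T η).distSq_nonneg u
  have h3 := log_det_prec_le (U := U) (g := g) (b := b) h.pos T η
  linarith

end Trajectory

section Trajectory

variable {d : ℕ} {σ : ℝ} {U : ℕ → Set (Fin d → ℝ)} {g : ℕ → Fin d → ℝ} {b : ℕ → ℝ} {T : ℕ}

/-! ### The controller's weights -/

variable (σ U g b) in
/-- The clipped surrogate loss of the `η`-expert in round `t`. -/
noncomputable def expertLoss (η : ℝ) (t : ℕ) : ℝ :=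
  surrogate η (prediction σ U g b t) (clippedGrad g b t) (expertPrediction σ U g b η t)

open Classical in
lemma weight_succ (n : ℕ) (η : ℝ) : (state σ U g b (n + 1)).weight η =
    if η ∈ activeSet b (n + 1) then
      if ResetNeeded b (state σ U g b n).epoch (n + 1) then 1
      else (state σ U g b n).weight η * Real.exp (-expertLoss σ U g b η (n + 1)) /
          (∑ᶠ ζ ∈ activeSet b (n + 1), (state σ U g b n).weight ζ *
            Real.exp (-expertLoss σ U g b ζ (n + 1))) *
        ∑ᶠ ζ ∈ activeSet b (n + 1), (state σ U g b n).weight ζ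
    else (state σ U g b n).weight η := rfl

open Classical in
lemma epoch_succ (n : ℕ) : (state σ U g b (n + 1)).epoch =
    if ResetNeeded b (state σ U g b n).epoch (n + 1) then n + 1 else (state σ U g b n).epoch := rfl

lemma Admissible.weight_pos (h : Admissible σ U g b T) {n : ℕ} (hn : n ≤ T) (η : ℝ) :
    0 < (state σ U g b n).weight η := by
  induction n generalizing η with
  | zero => simp [state]
  | succ n ih =>
    have ih := ih (by omega)
    obtain ⟨A, hA⟩ := exists_finset_activeSet b (h.nonneg_of_le (by omega : n ≤ T))
    rw [weight_succ]
    split_ifs with h1 h2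
    · exact one_pos
    · rw [← hA, finsum_mem_coe_finset, finsum_mem_coe_finset]
      have hne : A.Nonempty := ⟨η, by rwa [← Finset.mem_coe, hA]⟩
      have h3 : 0 < ∑ ζ ∈ A, (state σ U g b n).weight ζ *
          Real.exp (-expertLoss σ U g b ζ (n + 1)) :=
        Finset.sum_pos (fun ζ _ => mul_pos (ih ζ) (Real.exp_pos _)) hne
      have h4 : 0 < ∑ ζ ∈ A, (state σ U g b n).weight ζ := Finset.sum_pos (fun ζ _ => ih ζ) hne
      have := ih η
      positivity
    · exact ih η

/-- The purpose of clipping: the clipped range is at most B_{t-1}, for which activity already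
guarantees 2ηB_{t-1} ≤ 1, however large b_t turns out to be. -/
lemma Admissible.abs_clip_le (h : Admissible σ U g b T) {n : ℕ} (hn : n + 1 ≤ T) {η : ℝ}
    (hη : η ∈ activeSet b (n + 1)) :
    |η * ((expertPrediction σ U g b η (n + 1) - prediction σ U g b (n + 1)) ⬝ᵥ
      clippedGrad g b (n + 1))| ≤ 1 / 2 := by
  obtain ⟨h1, h2, h3, h4⟩ := (mem_activeSet b (h.nonneg_of_le (by omega : n ≤ T))).1 hη
  have hη0 := pos_of_mem_grid h1
  have ht : n + 1 ∈ Finset.Icc 1 T := Finset.mem_Icc.2 ⟨by omega, hn⟩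
  have h5 := mul_le_mul_of_nonneg_left (h.abs_expert_le ht hη) (clip_nonneg b (n + 1))
  have h6 := mul_clip_le b (t := n + 1) (by omega)
  rw [Nat.add_sub_cancel, mul_comm] at h6
  change |η * (_ ⬝ᵥ (clip b (n + 1) • g (n + 1)))| ≤ _
  rw [dotProduct_smul, smul_eq_mul, abs_mul, abs_mul, abs_of_pos hη0,
    abs_of_nonneg (clip_nonneg b _)]
  have := mul_le_mul_of_nonneg_left (h5.trans h6) hη0.le
  linarith

/-- The mix loss of the controller is nonnegative: the total weight does not increase before
normalization. -/
lemma Admissible.sum_weight_mul_exp_le (h : Admissible σ U g b T) {n : ℕ} (hn : n + 1 ≤ T)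
    {A : Finset ℝ} (hA : (A : Set ℝ) = activeSet b (n + 1)) :
    ∑ ζ ∈ A, (state σ U g b n).weight ζ * Real.exp (-expertLoss σ U g b ζ (n + 1)) ≤
      ∑ ζ ∈ A, (state σ U g b n).weight ζ := by
  rcases A.eq_empty_or_nonempty with rfl | hne
  · simp
  have hmem {ζ : ℝ} (hζ : ζ ∈ A) : ζ ∈ activeSet b (n + 1) := by rwa [← hA, Finset.mem_coe]
  have hw := h.weight_pos (by omega : n ≤ T)
  have hb := h.nonneg_of_le (by omega : n ≤ T)
  have hpos : 0 < ∑ ζ ∈ A, (state σ U g b n).weight ζ * ζ :=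
    Finset.sum_pos (fun ζ hζ => mul_pos (hw ζ)
      (pos_of_mem_grid ((mem_activeSet b hb).1 (hmem hζ)).1)) hne
  have hpred : (∑ ζ ∈ A, (state σ U g b n).weight ζ * ζ) • prediction σ U g b (n + 1) =
      ∑ ζ ∈ A, ((state σ U g b n).weight ζ * ζ) • expertPrediction σ U g b ζ (n + 1) := by
    have hA0 : activeSet b (n + 1) ≠ ∅ := by
      rw [← hA]; simpa using hne.ne_empty
    change _ • (state σ U g b n).predict (activeSet b (n + 1)) (U (n + 1)) = _
    rw [State.predict, if_neg hA0, ← hA, finsum_mem_coe_finset, finsum_mem_coe_finset, smul_smul,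
      mul_inv_cancel₀ hpos.ne', one_smul]
    rfl
  -- The controller's weighted mean is chosen to cancel exactly these linear terms.
  have hzero : ∑ ζ ∈ A, (state σ U g b n).weight ζ *
      (ζ * ((expertPrediction σ U g b ζ (n + 1) - prediction σ U g b (n + 1)) ⬝ᵥ
        clippedGrad g b (n + 1))) = 0 := by
    have e := congrArg (· ⬝ᵥ clippedGrad g b (n + 1)) hpred
    simp only [smul_dotProduct, sum_dotProduct, smul_eq_mul, Finset.sum_mul] at e
    simp only [sub_dotProduct, mul_sub, Finset.sum_sub_distrib, ← mul_assoc]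
    rw [e, sub_self]
  calc ∑ ζ ∈ A, (state σ U g b n).weight ζ * Real.exp (-expertLoss σ U g b ζ (n + 1))
      ≤ ∑ ζ ∈ A, (state σ U g b n).weight ζ *
        (1 - ζ * ((expertPrediction σ U g b ζ (n + 1) - prediction σ U g b (n + 1)) ⬝ᵥ
          clippedGrad g b (n + 1))) :=
        Finset.sum_le_sum fun ζ hζ => mul_le_mul_of_nonneg_left
          (exp_neg_add_sq_le (h.abs_clip_le hn (hmem hζ))) (hw ζ).le
    _ = ∑ ζ ∈ A, (state σ U g b n).weight ζ := by
        simp only [mul_sub, mul_one, Finset.sum_sub_distrib, hzero, sub_zero]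

lemma weight_eq_one_of_forall_notMem {n : ℕ} {η : ℝ}
    (hη : ∀ t < n, η ∉ activeSet b (t + 1)) : (state σ U g b n).weight η = 1 := by
  induction n with
  | zero => rfl
  | succ n ih =>
    rw [weight_succ, if_neg (hη n (by omega))]
    exact ih fun t ht => hη t (by omega)

/-- A reset touches only active rates. A rate this small that is inactive has never been active, so
it still has its initial weight 1. -/
lemma Admissible.weight_eq_one_of_reset (h : Admissible σ U g b T) {n : ℕ} (hn : n + 1 ≤ T)
    (hr : ResetNeeded b (state σ U g b n).epoch (n + 1)) {η : ℝ}
    (hη : η ∈ grid) (hηB : 2 * η * runMax b (n + 1) ≤ 1) :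
    (state σ U g b (n + 1)).weight η = 1 := by
  by_cases hA : η ∈ activeSet b (n + 1)
  · rw [weight_succ, if_pos hA, if_pos hr]
  · refine weight_eq_one_of_forall_notMem fun t ht => ?_
    refine notMem_activeSet_of_le b (h.nonneg_of_le (by omega : n ≤ T)) ?_ hA (by omega)
    exact (mul_le_mul_of_nonneg_left (runMax_mono b (Nat.le_succ n))
      (by have := pos_of_mem_grid hη; positivity)).trans hηB

/-! ### Epochs -/

lemma epoch_le (n : ℕ) : (state σ U g b n).epoch ≤ n := by
  induction n with
  | zero => rfl
  | succ n ih =>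
    rw [epoch_succ]
    split_ifs <;> omega

lemma runMax_eq_zero_of_epoch (n : ℕ) (h : (state σ U g b n).epoch = 0) : runMax b n = 0 := by
  cases n with
  | zero => rfl
  | succ n =>
    rw [epoch_succ] at h
    split_ifs at h with hr
    rw [h, ResetNeeded, runMax, zero_mul, gt_iff_lt, not_lt] at hr
    exact le_antisymm hr (runMax_nonneg b _)

/-- The absence of a reset is the bound by the sum; the 1 covers the moment right after a reset and
n = 0. -/
lemma runMax_le_epoch (n : ℕ) : runMax b n ≤ runMax b (state σ U g b n).epoch *
    max 1 (∑ s ∈ Finset.Icc 1 n, b s / runMax b s) := by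
  have h1 (τ n : ℕ) : runMax b τ ≤
      runMax b τ * max 1 (∑ s ∈ Finset.Icc 1 n, b s / runMax b s) :=
    le_mul_of_one_le_right (runMax_nonneg b τ) (le_max_left _ _)
  cases n with
  | zero => exact h1 0 0
  | succ n =>
    rw [epoch_succ]
    split_ifs with hr
    · exact h1 _ _
    · exact (not_lt.1 hr).trans
        (mul_le_mul_of_nonneg_left (le_max_right _ _) (runMax_nonneg b _))

lemma resetNeeded_epoch (n k : ℕ) (h : (state σ U g b n).epoch = k + 1) :
    ResetNeeded b (state σ U g b k).epoch (k + 1) := by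
  induction n with
  | zero => simp [state] at h
  | succ n ih =>
    rw [epoch_succ] at h
    split_ifs at h with hr
    · obtain rfl : n = k := by omega
      exact hr
    · exact ih h

variable (σ U g b) in
open Classical in
/-- The cumulative negative clipped loss of the `η`-expert in the rounds from `m` to `n`. -/
noncomputable def gain (η : ℝ) (m n : ℕ) : ℝ :=
  ∑ t ∈ Finset.Icc m n, if η ∈ activeSet b t then -expertLoss σ U g b η t else 0

/-- Two invariants of an epoch. Normalization multiplies active weights by a factor at least 1, so a
weight dominates the exponential of its gain. It also preserves the total over the active set, while
rates of G outside that set keep their weights, so the total over G stays what it was at the start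
of the epoch. -/
lemma Admissible.weight_epoch (h : Admissible σ U g b T) {n : ℕ} (hn : n ≤ T) :
    (∀ η ∈ grid, 2 * η * runMax b (state σ U g b n).epoch ≤ 1 →
      Real.exp (gain σ U g b η ((state σ U g b n).epoch + 1) n) ≤ (state σ U g b n).weight η) ∧
    ∀ G : Finset ℝ, (∀ η ∈ G, η ∈ grid ∧ 2 * η * runMax b (state σ U g b n).epoch ≤ 1) →
      (∀ t ∈ Finset.Icc ((state σ U g b n).epoch + 1) n, activeSet b t ⊆ G) →
      ∑ η ∈ G, (state σ U g b n).weight η = G.card := by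
  induction n with
  | zero => simp [state, gain]
  | succ n ih =>
    obtain ⟨ih1, ih2⟩ := ih (by omega)
    rw [epoch_succ]
    split_ifs with hr
    · constructor
      · intro η hη hηB
        rw [h.weight_eq_one_of_reset hn hr hη hηB]
        simp [gain]
      · intro G hG _
        rw [Finset.sum_congr rfl fun η hη =>
          h.weight_eq_one_of_reset hn hr (hG η hη).1 (hG η hη).2]
        simp
    · obtain ⟨A, hA⟩ := exists_finset_activeSet b (h.nonneg_of_le (by omega : n ≤ T))
      have hτ := epoch_le (σ := σ) (U := U) (g := g) (b := b) n
      set τ := (state σ U g b n).epoch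
      have hw := h.weight_pos (by omega : n ≤ T)
      have hmix := h.sum_weight_mul_exp_le hn hA
      set M := ∑ ζ ∈ A, (state σ U g b n).weight ζ * Real.exp (-expertLoss σ U g b ζ (n + 1))
      set W := ∑ ζ ∈ A, (state σ U g b n).weight ζ
      have hpos {η : ℝ} (hη : η ∈ A) : 0 < M :=
        Finset.sum_pos (fun ζ _ => mul_pos (hw ζ) (Real.exp_pos _)) ⟨η, hη⟩
      have hact {η : ℝ} (hη : η ∈ A) : (state σ U g b (n + 1)).weight η =
          (state σ U g b n).weight η * Real.exp (-expertLoss σ U g b η (n + 1)) / M * W := by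
        rw [weight_succ, if_pos (by rwa [← hA, Finset.mem_coe]), if_neg hr, ← hA,
          finsum_mem_coe_finset, finsum_mem_coe_finset]
      have hinact {η : ℝ} (hη : η ∉ A) : (state σ U g b (n + 1)).weight η =
          (state σ U g b n).weight η := by
        rw [weight_succ, if_neg (by rwa [← hA, Finset.mem_coe])]
      constructor
      · intro η hη hηB
        rw [gain, Finset.sum_Icc_succ_top (by omega), Real.exp_add]
        have h1 := ih1 η hη hηB
        by_cases hηA : η ∈ A
        · rw [if_pos (by rwa [← hA, Finset.mem_coe]), hact hηA, div_mul_eq_mul_div,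
            le_div_iff₀ (hpos hηA)]
          exact mul_le_mul (mul_le_mul_of_nonneg_right h1 (Real.exp_pos _).le) hmix
            (hpos hηA).le (mul_pos (hw η) (Real.exp_pos _)).le
        · rw [if_neg (by rwa [← hA, Finset.mem_coe]), hinact hηA, Real.exp_zero, mul_one]
          exact h1
      · intro G hG hGA
        have hAG : A ⊆ G := by
          have := hGA (n + 1) (Finset.mem_Icc.2 ⟨by omega, le_rfl⟩)
          rwa [← hA, Finset.coe_subset] at this
        rw [← ih2 G hG fun t ht => hGA t (Finset.Icc_subset_Icc_right (by omega) ht)]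
        classical
        rw [← Finset.sum_sdiff hAG, ← Finset.sum_sdiff hAG]
        congr 1
        · exact Finset.sum_congr rfl fun η hη => hinact (Finset.mem_sdiff.1 hη).2
        · rw [Finset.sum_congr rfl fun η hη => hact hη, ← Finset.sum_mul, ← Finset.sum_div]
          rcases A.eq_empty_or_nonempty with h0 | ⟨η, hη⟩
          · simp [W, h0]
          · change M / M * W = W
            rw [div_self (hpos hη).ne', one_mul]

/-- The controller's regret with respect to any expert within one epoch. -/
lemma Admissible.gain_epoch_le (h : Admissible σ U g b T) {n : ℕ} (hn : n + 1 ≤ T) (η : ℝ) :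
    gain σ U g b η ((state σ U g b n).epoch + 1) (n + 1) ≤
      Real.log (ceilPos (2 * Real.logb 2 T)) := by
  have hb := h.nonneg_of_le (by omega : n ≤ T)
  have hτ := epoch_le (σ := σ) (U := U) (g := g) (b := b) n
  have hNR := runMax_le_epoch (σ := σ) (U := U) (g := g) (b := b) n
  have hw := h.weight_pos (by omega : n ≤ T)
  obtain ⟨hexp, hsum⟩ := h.weight_epoch (by omega : n ≤ T)
  have hz := runMax_eq_zero_of_epoch (σ := σ) (U := U) (g := g) (b := b) n
  set τ := (state σ U g b n).epoch
  by_cases hex : ∃ t ∈ Finset.Icc (τ + 1) (n + 1), η ∈ activeSet b t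
  swap
  · push Not at hex
    rw [gain, Finset.sum_congr rfl fun t ht => if_neg (hex t ht), Finset.sum_const_zero]
    exact Real.log_nonneg (one_le_ceilPos _)
  have hmem : ∀ t ∈ Finset.Icc (τ + 1) (n + 1), ∀ ζ ∈ activeSet b t,
      ζ ∈ grid ∧ 0 < runMax b n ∧ 1 < 2 * ζ * horizon b n ∧ 2 * ζ * runMax b τ ≤ 1 := by
    intro t ht ζ hζ
    obtain ⟨ht1, ht2⟩ := Finset.mem_Icc.1 ht
    obtain ⟨s, rfl⟩ : ∃ s, t = s + 1 := ⟨t - 1, by omega⟩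
    obtain ⟨h1, h2, h3, h4⟩ := (mem_activeSet b (h.nonneg_of_le (by omega : s ≤ T))).1 hζ
    have hζ0 : 0 ≤ 2 * ζ := by have := pos_of_mem_grid h1; positivity
    exact ⟨h1, h2.trans_le (runMax_mono b (by omega)),
      h3.trans_le (mul_le_mul_of_nonneg_left (horizon_mono b (by omega) hb) hζ0),
      (mul_le_mul_of_nonneg_left (runMax_mono b (by omega)) hζ0).trans h4⟩
  obtain ⟨t0, ht0, hη0⟩ := hex
  obtain ⟨hηg, hBn, hη1, hη2⟩ := hmem t0 ht0 η hη0
  -- The initial epoch has B_0 = 0 and would force B_n = 0, but some rate is active.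
  have hBτ : 0 < runMax b τ := by
    refine lt_of_le_of_ne (runMax_nonneg b τ) fun h0 => ?_
    rw [← h0, zero_mul] at hNR
    linarith
  have hL : 0 < horizon b n := hBn.trans_le (runMax_le_horizon b hb)
  set G := dyadic (1 / (2 * horizon b n)) (1 / (2 * runMax b τ)) with hG
  have hGmem (ζ : ℝ) : ζ ∈ G ↔
      ζ ∈ grid ∧ 1 < 2 * ζ * horizon b n ∧ 2 * ζ * runMax b τ ≤ 1 := by
    rw [hG, mem_dyadic (by positivity) (by positivity), Set.mem_inter_iff, Set.mem_Ioc,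
      div_lt_iff₀ (by positivity), le_div_iff₀ (by positivity),
      show ζ * (2 * horizon b n) = 2 * ζ * horizon b n by ring,
      show ζ * (2 * runMax b τ) = 2 * ζ * runMax b τ by ring]
  have hsub : ∀ t ∈ Finset.Icc (τ + 1) (n + 1), activeSet b t ⊆ G := by
    intro t ht ζ hζ
    obtain ⟨h1, -, h3, h4⟩ := hmem t ht ζ hζ
    exact (hGmem ζ).2 ⟨h1, h3, h4⟩
  have hcard : (G.card : ℝ) ≤ ceilPos (2 * Real.logb 2 T) := by
    refine card_dyadic_le (by positivity) (by positivity) (by omega) ?_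
    have hT : (n : ℝ) + 1 ≤ T := by exact_mod_cast hn
    have hn0 : (0 : ℝ) ≤ n := Nat.cast_nonneg n
    have h1 : runMax b n ≤ runMax b τ * T := by
      refine hNR.trans (mul_le_mul_of_nonneg_left (max_le ?_ ?_) hBτ.le)
      · linarith
      · have := sum_div_runMax_le b n
        linarith
    -- One factor T comes from the growth of B within the epoch, the other from the number of
    -- rounds.
    have h2 : horizon b n ≤ runMax b τ * T * T :=
      (horizon_le b n).trans (mul_le_mul h1 hT (by positivity) (by positivity))
    rw [div_mul_eq_mul_div, one_mul, div_le_div_iff₀ (by positivity) (by positivity)]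
    linarith
  have hW : ∑ ζ ∈ G, (state σ U g b n).weight ζ = G.card :=
    hsum G (fun ζ hζ => ⟨((hGmem ζ).1 hζ).1, ((hGmem ζ).1 hζ).2.2⟩)
      fun t ht => hsub t (Finset.Icc_subset_Icc_right (by omega) ht)
  -- Round n + 1 may end in a reset that discards its weight update, so it is handled through the
  -- unnormalized weights.
  have hlast : Real.exp (gain σ U g b η (τ + 1) (n + 1)) ≤ G.card := by
    rw [gain, Finset.sum_Icc_succ_top (by omega), Real.exp_add]
    change Real.exp (gain σ U g b η (τ + 1) n) * _ ≤ _
    have h1 := hexp η hηg hη2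
    split_ifs with hηA
    · obtain ⟨A, hA⟩ := exists_finset_activeSet b hb
      have hAG : A ⊆ G := by
        have := hsub (n + 1) (Finset.mem_Icc.2 ⟨by omega, le_rfl⟩)
        rwa [← hA, Finset.coe_subset] at this
      rw [← hA, Finset.mem_coe] at hηA
      calc _ ≤ (state σ U g b n).weight η * Real.exp (-expertLoss σ U g b η (n + 1)) :=
            mul_le_mul_of_nonneg_right h1 (Real.exp_pos _).le
        _ ≤ ∑ ζ ∈ A, (state σ U g b n).weight ζ * Real.exp (-expertLoss σ U g b ζ (n + 1)) :=
            Finset.single_le_sum (f := fun ζ => (state σ U g b n).weight ζ *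
              Real.exp (-expertLoss σ U g b ζ (n + 1)))
              (fun ζ _ => (mul_pos (hw ζ) (Real.exp_pos _)).le) hηA
        _ ≤ ∑ ζ ∈ A, (state σ U g b n).weight ζ := h.sum_weight_mul_exp_le hn hA
        _ ≤ ∑ ζ ∈ G, (state σ U g b n).weight ζ :=
            Finset.sum_le_sum_of_subset_of_nonneg hAG fun ζ _ _ => (hw ζ).le
        _ = G.card := hW
    · rw [Real.exp_zero, mul_one, ← hW]
      exact h1.trans (Finset.single_le_sum (f := fun ζ => (state σ U g b n).weight ζ)
        (fun ζ _ => (hw ζ).le) ((hGmem η).2 ⟨hηg, hη1, hη2⟩))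
  rw [← Real.log_exp (gain σ U g b η (τ + 1) (n + 1))]
  exact Real.log_le_log (Real.exp_pos _) (hlast.trans hcard)

/-- All rounds but those of the last two epochs have a negligible total range. -/
lemma Admissible.exists_early (h : Admissible σ U g b T) :
    ∃ m ≤ T, ∑ t ∈ Finset.Icc 1 m, b t ≤ runMax b T ∧
      ∀ η, gain σ U g b η (m + 1) T ≤ 2 * Real.log (ceilPos (2 * Real.logb 2 T)) := by
  have hlog := Real.log_nonneg (one_le_ceilPos (2 * Real.logb 2 T))
  obtain _ | n := T
  · exact ⟨0, le_rfl, by simp [runMax], fun η => by simpa [gain] using hlog⟩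
  -- The state before the last round is used, so a reset after that round does not count.
  have hτ := epoch_le (σ := σ) (U := U) (g := g) (b := b) n
  have hlast := h.gain_epoch_le (n := n) le_rfl
  rcases hτ2 : (state σ U g b n).epoch with _ | k
  · refine ⟨0, by omega, by simpa using runMax_nonneg b _, fun η => ?_⟩
    have := hlast η
    rw [hτ2] at this
    linarith
  · have hk := epoch_le (σ := σ) (U := U) (g := g) (b := b) k
    have hr := resetNeeded_epoch n k hτ2
    refine ⟨(state σ U g b k).epoch, by omega, ?_, fun η => ?_⟩
    · set τ := (state σ U g b k).epoch
      -- The reset after round k + 1 says B_{k+1} > B_τ ∑_{s ≤ k+1} b_s / B_s, and the part of the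
      -- sum up to τ already dominates ∑_{s ≤ τ} b_s.
      refine (sum_le_runMax_mul b τ (h.nonneg_of_le (by omega))).trans ?_
      refine le_trans (mul_le_mul_of_nonneg_left ?_ (runMax_nonneg b τ))
        ((le_of_lt hr).trans (runMax_mono b (by omega)))
      refine Finset.sum_le_sum_of_subset_of_nonneg (Finset.Icc_subset_Icc_right (by omega)) ?_
      intro t ht _
      exact div_nonneg (h.nonneg_of_le (by omega : k + 1 ≤ n + 1) t ht) (runMax_nonneg b t)
    · have h1 := h.gain_epoch_le (n := k) (by omega) η
      have h2 := hlast η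
      rw [hτ2] at h2
      have h3 : gain σ U g b η ((state σ U g b k).epoch + 1) (n + 1) =
          gain σ U g b η ((state σ U g b k).epoch + 1) (k + 1) +
            gain σ U g b η (k + 1 + 1) (n + 1) := sum_Icc_split _ (by omega) (by omega)
      linarith

/-! ### The regret for a fixed learning rate -/

/-- The surrogate loss of an active expert is controlled by its clipped version. -/
lemma Admissible.neg_surrogate_le (h : Admissible σ U g b T) {t : ℕ} (ht : t ∈ Finset.Icc 1 T)
    {η : ℝ} (hη0 : 0 < η) (hA : η ∈ activeSet b t) :
    -surrogate η (prediction σ U g b t) (g t) (expertPrediction σ U g b η t) ≤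
        η * b t ∧
      -surrogate η (prediction σ U g b t) (g t) (expertPrediction σ U g b η t) ≤
        -expertLoss σ U g b η t + η * (b t * (1 - clip b t)) := by
  have h1 := h.abs_expert_le ht hA
  have hc0 := clip_nonneg b t
  have hc1 := clip_le_one b t
  have e : expertLoss σ U g b η t = η * (clip b t *
      ((expertPrediction σ U g b η t - prediction σ U g b t) ⬝ᵥ g t)) + (η * (clip b t *
      ((expertPrediction σ U g b η t - prediction σ U g b t) ⬝ᵥ g t))) ^ 2 := by
    change η * (_ ⬝ᵥ (clip b t • g t)) + (η * (_ ⬝ᵥ (clip b t • g t))) ^ 2 = _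
    simp only [dotProduct_smul, smul_eq_mul]
  rw [e, surrogate]
  set x := (expertPrediction σ U g b η t - prediction σ U g b t) ⬝ᵥ g t
  set c := clip b t
  have hx := (abs_le.1 h1).1
  have h2 : η * -x ≤ η * b t := mul_le_mul_of_nonneg_left (by linarith) hη0.le
  have h3 := mul_le_mul_of_nonneg_right h2 (sub_nonneg.2 hc1)
  -- Clipping shrinks the quadratic term, which only helps; just the linear term has to be paid for.
  have h4 : 0 ≤ (η * x) ^ 2 * ((1 - c) * (1 + c)) :=
    mul_nonneg (sq_nonneg _) (mul_nonneg (by linarith) (by linarith))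
  constructor
  · nlinarith [sq_nonneg (η * x)]
  · nlinarith

/-- The two logarithms in `Z'` come from the last two epochs and its 1/2 from inactive rounds. One
ηB_T pays for the early rounds, the other for clipping. -/
lemma Admissible.regret_le_of_mem_grid (h : Admissible σ U g b T) {η : ℝ} (hη : η ∈ grid)
    (hηB : 2 * η * runMax b T ≤ 1) {u : Fin d → ℝ} (hu : ∀ t ∈ Finset.Icc 1 T, u ∈ U t) :
    η * linRegret (prediction σ U g b) g u T ≤
      η ^ 2 * variance (prediction σ U g b) g u T + expertRegret σ U g b η u T + Z' T +
        2 * η * runMax b T := by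
  classical
  have hη0 := pos_of_mem_grid hη
  obtain ⟨m, hmT, hearly, hgain⟩ := h.exists_early
  have hlhs : η * linRegret (prediction σ U g b) g u T -
      η ^ 2 * variance (prediction σ U g b) g u T =
      ∑ t ∈ Finset.Icc 1 T, -surrogate η (prediction σ U g b t) (g t) u := by
    rw [linRegret, variance, Finset.mul_sum, Finset.mul_sum, ← Finset.sum_sub_distrib]
    refine Finset.sum_congr rfl fun t _ => ?_
    rw [surrogate, ← neg_sub u, neg_dotProduct]
    ring
  set r : ℕ → ℝ := fun t => if η ∈ activeSet b t then
    surrogate η (prediction σ U g b t) (g t) (expertPrediction σ U g b η t) -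
      surrogate η (prediction σ U g b t) (g t) u else 0 with hr
  set p : ℕ → ℝ := fun t => if η ∈ activeSet b t then -expertLoss σ U g b η t else 0 with hp
  set q : ℕ → ℝ := fun t => if η ∈ activeSet b t then 0 else b t * clip b t with hq
  set c : ℕ → ℝ := fun t => b t * (1 - clip b t) with hc
  -- The crude first bound is for the rounds up to m, the second for the later ones; both keep r, so
  -- the expert's regret is taken over all rounds.
  have hround : ∀ t ∈ Finset.Icc 1 T,
      -surrogate η (prediction σ U g b t) (g t) u ≤ r t + η * b t ∧
      -surrogate η (prediction σ U g b t) (g t) u ≤ r t + (p t + η * q t + η * c t) := by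
    intro t ht
    by_cases hA : η ∈ activeSet b t
    · obtain ⟨h1, h2⟩ := h.neg_surrogate_le ht hη0 hA
      simp only [hr, hp, hq, hc, if_pos hA]
      constructor <;> linarith
    · simp only [hr, hp, hq, hc, if_neg hA]
      have h1 := (abs_le.1 (h.bound t ht u (hu t ht))).1
      have h2 : -surrogate η (prediction σ U g b t) (g t) u ≤ η * b t := by
        rw [surrogate]
        nlinarith [sq_nonneg (η * ((u - prediction σ U g b t) ⬝ᵥ g t))]
      constructor <;> linarith
  have hb := h.nonneg
  have hsplit := sum_Icc_split (fun t => -surrogate η (prediction σ U g b t) (g t) u)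
    (a := 1) (by omega) hmT
  have h1 := Finset.sum_le_sum fun t (ht : t ∈ Finset.Icc 1 m) =>
    (hround t (Finset.Icc_subset_Icc_right hmT ht)).1
  have h2 := Finset.sum_le_sum fun t (ht : t ∈ Finset.Icc (m + 1) T) =>
    (hround t (Finset.Icc_subset_Icc_left (by omega) ht)).2
  simp only [Finset.sum_add_distrib, ← Finset.mul_sum] at h1 h2
  have hrs := sum_Icc_split r (a := 1) (by omega) hmT
  have hreg : ∑ t ∈ Finset.Icc 1 T, r t = expertRegret σ U g b η u T := rfl
  have hps : ∑ t ∈ Finset.Icc (m + 1) T, p t = gain σ U g b η (m + 1) T := rfl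
  have hqs : η * ∑ t ∈ Finset.Icc (m + 1) T, q t ≤ 1 / 2 := by
    refine le_trans (mul_le_mul_of_nonneg_left (Finset.sum_le_sum_of_subset_of_nonneg
      (Finset.Icc_subset_Icc_left (by omega)) fun t ht _ => ?_) hη0.le)
      (sum_inactive_le b hb hη hηB le_rfl)
    simp only [hq]
    split_ifs
    · exact le_rfl
    · exact mul_nonneg (hb t ht) (clip_nonneg b t)
  have hcs : η * ∑ t ∈ Finset.Icc (m + 1) T, c t ≤ η * runMax b T := by
    refine mul_le_mul_of_nonneg_left (le_trans (Finset.sum_le_sum_of_subset_of_nonneg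
      (Finset.Icc_subset_Icc_left (by omega)) fun t ht _ => ?_)
      (sum_mul_one_sub_clip_le b T)) hη0.le
    exact mul_nonneg (hb t ht) (sub_nonneg.2 (clip_le_one b t))
  have hes := mul_le_mul_of_nonneg_left hearly hη0.le
  have hg := hgain η
  rw [Z']
  linarith

end Trajectory

/-! ### Tuning the learning rate -/

/-- The ideal rate is √(A / V), capped at 1 / (2B); rounding down to a power of two loses a factor
less than 2. -/
lemma le_of_forall_mem_grid {R V A B : ℝ} (hV : 0 ≤ V) (hA : 0 < A) (hB : 0 < B)
    (h : ∀ η ∈ grid, 2 * η * B ≤ 1 → η * R ≤ η ^ 2 * V + A + 2 * η * B) :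
    R ≤ 5 / 2 * √(V * A) + 5 * B * A + 2 * B := by
  set v := √V with hv
  set a := √A with ha
  have hv0 : 0 ≤ v := Real.sqrt_nonneg V
  have ha0 : 0 < a := Real.sqrt_pos.2 hA
  have hv2 : v ^ 2 = V := Real.sq_sqrt hV
  have ha2 : a ^ 2 = A := Real.sq_sqrt hA.le
  rw [Real.sqrt_mul hV, ← hv, ← ha, ← ha2]
  rw [← hv2, ← ha2] at h
  by_cases hcase : 2 * B * a ≤ v
  · have hvpos : 0 < v := lt_of_lt_of_le (by positivity) hcase
    obtain ⟨η, hη, h1, h2⟩ := exists_mem_grid (div_pos ha0 hvpos)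
    have hη0 := pos_of_mem_grid hη
    rw [le_div_iff₀ hvpos] at h2
    rw [div_div, div_lt_iff₀ (by positivity)] at h1
    have h3 : 2 * η * B ≤ 1 := by
      by_contra! h4
      nlinarith
    have h4 := h η hη h3
    -- For x = ηv / a in [1/2, 2] one has x + 1/x ≤ 5/2, the source of that constant.
    have h5 : 0 ≤ (2 * (η * v) - a) * (2 * a - η * v) :=
      mul_nonneg (by linarith) (by linarith)
    refine le_of_mul_le_mul_left ?_ hη0
    have h6 : 0 ≤ η * (5 * B * a ^ 2) := by positivity
    nlinarith
  · push Not at hcase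
    obtain ⟨η, hη, h1, h2⟩ := exists_mem_grid (m := 1 / (2 * B)) (by positivity)
    have hη0 := pos_of_mem_grid hη
    rw [le_div_iff₀ (by positivity)] at h2
    rw [div_div, div_lt_iff₀ (by positivity)] at h1
    have h4 := h η hη (by linarith)
    refine le_of_mul_le_mul_left ?_ hη0
    have h5 : η * v ≤ a := by
      have h7 := mul_le_mul_of_nonneg_left hcase.le hη0.le
      have h8 := mul_le_mul_of_nonneg_right h2 ha0.le
      linarith
    have h6 : η ^ 2 * v ^ 2 ≤ η * (v * a) := by
      have := mul_le_mul_of_nonneg_left h5 (mul_nonneg hη0.le hv0)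
      linarith
    -- Here η > 1 / (4B), so A / η ≤ 4BA.
    have h9 : a ^ 2 ≤ η * (4 * B * a ^ 2) := by
      have := mul_le_mul_of_nonneg_right h1.le (sq_nonneg a)
      linarith
    have h10 : 0 ≤ η * (v * a) := by positivity
    have h11 : 0 ≤ η * (B * a ^ 2) := by positivity
    linarith

/-! ### Estimates for the quantities in the final bounds. -/

lemma gradCov_posSemidef {d : ℕ} (g : ℕ → Fin d → ℝ) (T : ℕ) : (gradCov g T).PosSemidef :=
  posSemidef_sum _ fun t _ => posSemidef_vecMulVec_self (g t)

lemma trace_gradCov {d : ℕ} (g : ℕ → Fin d → ℝ) (T : ℕ) : (gradCov g T).trace = gradSq g T := by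
  simp [gradCov, gradSq, sqNorm, trace_sum]

lemma gradSq_nonneg {d : ℕ} (g : ℕ → Fin d → ℝ) (T : ℕ) : 0 ≤ gradSq g T :=
  Finset.sum_nonneg fun t _ => sqNorm_nonneg (g t)

lemma log_det_gradCov_le {d : ℕ} (σ : ℝ) (g : ℕ → Fin d → ℝ) (T : ℕ) {η B : ℝ} (hB : 0 < B)
    (hη0 : 0 < η) (hη : 2 * η * B ≤ 1) :
    Real.log (1 + (2 * η ^ 2 * σ ^ 2) • gradCov g T).det ≤ (gradCov g T).rank *
      Real.log (1 + σ ^ 2 * gradSq g T / (2 * B ^ 2 * (gradCov g T).rank)) := by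
  refine (log_det_one_add_le (gradCov_posSemidef g T) (by positivity)).trans ?_
  rw [trace_gradCov]
  have hS := gradSq_nonneg g T
  have hr : (0 : ℝ) ≤ (gradCov g T).rank := Nat.cast_nonneg _
  refine mul_le_mul_of_nonneg_left (Real.log_le_log (by positivity) ?_) hr
  have h1 : 2 * η ^ 2 ≤ 1 / (2 * B ^ 2) := by
    rw [le_div_iff₀ (by positivity)]
    nlinarith [mul_pos hη0 hB]
  have h2 := mul_le_mul_of_nonneg_right h1
    (by positivity : 0 ≤ σ ^ 2 * gradSq g T / (gradCov g T).rank)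
  have h3 : 1 / (2 * B ^ 2) * (σ ^ 2 * gradSq g T / (gradCov g T).rank) =
      σ ^ 2 * gradSq g T / (2 * B ^ 2 * (gradCov g T).rank) := by
    rw [div_mul_div_comm, one_mul]
  rw [h3] at h2
  have h4 : 2 * η ^ 2 * σ ^ 2 * gradSq g T / (gradCov g T).rank =
      2 * η ^ 2 * (σ ^ 2 * gradSq g T / (gradCov g T).rank) := by ring
  rw [h4]
  linarith

lemma variance_nonneg {d : ℕ} (w g : ℕ → Fin d → ℝ) (u : Fin d → ℝ) (T : ℕ) :
    0 ≤ variance w g u T := Finset.sum_nonneg fun _ _ => sq_nonneg _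

lemma half_le_Z' (T : ℕ) : 1 / 2 ≤ Z' T := by
  have := Real.log_nonneg (one_le_ceilPos (2 * Real.logb 2 T))
  rw [Z']
  linarith

lemma Z_eq_add_Z' {d : ℕ} (σ : ℝ) (g : ℕ → Fin d → ℝ) (b : ℕ → ℝ) (T : ℕ) :
    Z σ g b T = (gradCov g T).rank *
      Real.log (1 + σ ^ 2 * gradSq g T / (2 * runMax b T ^ 2 * (gradCov g T).rank)) + Z' T := by
  rw [Z, Z', add_assoc]

lemma Z'_le_Z {d : ℕ} (σ : ℝ) (g : ℕ → Fin d → ℝ) (b : ℕ → ℝ) (T : ℕ) : Z' T ≤ Z σ g b T := by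
  rw [Z_eq_add_Z']
  have hS := gradSq_nonneg g T
  refine le_add_of_nonneg_left (mul_nonneg (Nat.cast_nonneg _) (Real.log_nonneg ?_))
  exact le_add_of_nonneg_right (by positivity)

end MetaGrad

theorem theorem7 {d : ℕ} (σ : ℝ) (hσ : 0 < σ) (T : ℕ)
    (U : ℕ → Set (Fin d → ℝ)) (g : ℕ → Fin d → ℝ) (b : ℕ → ℝ)
    (hconv : ∀ t ∈ Finset.Icc 1 T, Convex ℝ (U t))
    (hzero : ∀ t ∈ Finset.Icc 1 T, (0 : Fin d → ℝ) ∈ U t)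
    (hproj : ∀ t ∈ Finset.Icc 1 T, MetaGrad.ProjectionsExist σ U g b t)
    (hb : ∀ t ∈ Finset.Icc 1 T, ∀ v ∈ U t,
      |dotProduct (v - MetaGrad.prediction σ U g b t) (g t)| ≤ b t)
    (hB : 0 < MetaGrad.runMax b T)
    (u : Fin d → ℝ) (hu : ∀ t ∈ Finset.Icc 1 T, u ∈ U t) :
    MetaGrad.linRegret (MetaGrad.prediction σ U g b) g u T ≤
        5 / 2 * Real.sqrt (MetaGrad.variance (MetaGrad.prediction σ U g b) g u T *
          (1 / (2 * σ ^ 2) * MetaGrad.sqNorm u + MetaGrad.Z σ g b T))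
        + 5 * MetaGrad.runMax b T *
          (1 / (2 * σ ^ 2) * MetaGrad.sqNorm u + MetaGrad.Z σ g b T)
        + 2 * MetaGrad.runMax b T ∧
      MetaGrad.linRegret (MetaGrad.prediction σ U g b) g u T ≤
        5 / 2 * Real.sqrt ((MetaGrad.variance (MetaGrad.prediction σ U g b) g u T
            + 2 * σ ^ 2 * MetaGrad.gradSq g T) *
          (1 / (2 * σ ^ 2) * MetaGrad.sqNorm u + MetaGrad.Z' T))
        + 5 * MetaGrad.runMax b T *
          (1 / (2 * σ ^ 2) * MetaGrad.sqNorm u + MetaGrad.Z' T)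
        + 2 * MetaGrad.runMax b T := by
  have h : MetaGrad.Admissible σ U g b T := ⟨hσ, hconv, hzero, hproj, hb⟩
  have hu0 : 0 ≤ 1 / (2 * σ ^ 2) * MetaGrad.sqNorm u :=
    mul_nonneg (by positivity) (MetaGrad.sqNorm_nonneg u)
  have hV := MetaGrad.variance_nonneg (MetaGrad.prediction σ U g b) g u T
  have hZ' := MetaGrad.half_le_Z' T
  have hZ := MetaGrad.Z'_le_Z σ g b T
  constructor
  · refine MetaGrad.le_of_forall_mem_grid hV (by linarith) hB fun η hη hηB => ?_
    have hη0 := MetaGrad.pos_of_mem_grid hη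
    have h1 := h.regret_le_of_mem_grid hη hηB hu
    have h2 := h.expertRegret_le_log_det hη0 hηB hu
    have h3 := MetaGrad.log_det_gradCov_le σ g T hB hη0 hηB
    rw [MetaGrad.Z_eq_add_Z']
    linarith
  · have hS := mul_nonneg (by positivity : 0 ≤ 2 * σ ^ 2) (MetaGrad.gradSq_nonneg g T)
    -- The expert's excess 2η²σ²∑‖g_t‖² is quadratic in η, so it joins the variance.
    refine MetaGrad.le_of_forall_mem_grid (add_nonneg hV hS) (by linarith) hB fun η hη hηB => ?_
    have hη0 := MetaGrad.pos_of_mem_grid hη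
    have h1 := h.regret_le_of_mem_grid hη hηB hu
    have h2 := h.expertRegret_le_gradSq hη0 hηB hu
    linarith
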